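/- An instance of discrete Colonel Blotto consists of non-negative integers $n$, $m$ (the numbers of troops of players 1 and 2), a number $k$ of battlefields, and positive integer weights $w_1,\dots,w_k$. A pure strategy of player 1 (player 2) is a vector of $k$ non-negative integers with sum at most $n$ (at most $m$). If the pure strategies $\mathbf x$, $\mathbf y$ are played, player 1 gets the utility $\mathsf u(\mathbf x,\mathbf y)=\sum_{i:\,x_i>y_i} w_i$. A mixed strategy $\mathbf x$ of player 1 is called $(u,p)$-maxmin if $\Pr_{\mathbf x'\sim \mathbf x,\ \mathbf y'\sim\mathbf y}[\mathsf u(\mathbf x',\mathbf y')\ge u]\ge p$ for every mixed strategy $\mathbf y$ of player 2, and a $2$-strategy if it assigns non-zero probability to at most two pure strategies. **Theorem.** There is a polynomial-time algorithm which, given an instance $(n,m,(w_1,\dots,w_k))$ and rational numbers $u,p\ge 0$, outputs a $(u/3,p)$-maxmin $2$-strategy of player 1 (its two pure strategies and their probabilities) whenever player 1 has a $(u,p)$-maxmin $2$-strategy. Here the running time, on a random access machine with unit-cost instructions and without multiplication, is bounded for every input by a polynomial in $n$, $m$, $k$ and the binary lengths of the weights $w_i$ and of the numerators and denominators of $u$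 and $p$. -/

import Mathlib

open scoped ENNReal NNRat

/-! ### A random access machine -/

namespace RAM

/-- A configuration: registers and a random access memory, all cells holding natural numbers. -/
structure State where
  reg : ℕ → ℕ
  mem : ℕ → ℕ

/-- Elementary instructions. There is no multiplication: apart from the fixed constants of a program,
an instruction at most doubles the largest number present. So numbers grow by at most one bit per
instruction, and counting one step per instruction agrees with Turing machine time, for inputs written
in binary, up to a polynomial. -/
inductive Instr where
  /-- `reg r := c` -/
  | const (r c : ℕ)
  /-- `reg r := reg a + reg b` -/
  | add (r a b : ℕ)
  /-- `reg r := reg a - reg b`, which is `0` if `reg a < reg b` -/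
  | sub (r a b : ℕ)
  /-- `reg r := ⌊reg a / reg b⌋`, which is `0` if `reg b = 0` -/
  | div (r a b : ℕ)
  /-- `reg r := reg a mod reg b`, which is `reg a` if `reg b = 0` -/
  | mod (r a b : ℕ)
  /-- `reg r := mem (reg a)` -/
  | load (r a : ℕ)
  /-- `mem (reg a) := reg b` -/
  | store (a b : ℕ)

/-- The effect of an elementary instruction. -/
def Instr.run : Instr → State → State
  | .const r c, s => { s with reg := Function.update s.reg r c }
  | .add r a b, s => { s with reg := Function.update s.reg r (s.reg a + s.reg b) }
  | .sub r a b, s => { s with reg := Function.update s.reg r (s.reg a - s.reg b) }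
  | .div r a b, s => { s with reg := Function.update s.reg r (s.reg a / s.reg b) }
  | .mod r a b, s => { s with reg := Function.update s.reg r (s.reg a % s.reg b) }
  | .load r a, s => { s with reg := Function.update s.reg r (s.mem (s.reg a)) }
  | .store a b, s => { s with mem := Function.update s.mem (s.reg a) (s.reg b) }

/-- Programs. -/
inductive Prog where
  | skip
  | instr (c : Instr)
  | seq (A B : Prog)
  /-- run `A` if `reg r ≠ 0`, and `B` if `reg r = 0` -/
  | ite (r : ℕ) (A B : Prog)
  /-- run `A` as long as `reg r ≠ 0` -/
  | loop (r : ℕ) (A : Prog)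

/-- `Exec A s t s'`: started in `s`, the program `A` halts in `s'` after exactly `t` steps. Each
elementary instruction and each test of a register is one step. -/
inductive Exec : Prog → State → ℕ → State → Prop where
  | skip (s : State) : Exec .skip s 1 s
  | instr (c : Instr) (s : State) : Exec (.instr c) s 1 (c.run s)
  | seq {A B : Prog} {s s' s'' : State} {t t' : ℕ} :
      Exec A s t s' → Exec B s' t' s'' → Exec (.seq A B) s (t + t') s''
  | ite_true {r : ℕ} {A B : Prog} {s s' : State} {t : ℕ} :
      s.reg r ≠ 0 → Exec A s t s' → Exec (.ite r A B) s (t + 1) s'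
  | ite_false {r : ℕ} {A B : Prog} {s s' : State} {t : ℕ} :
      s.reg r = 0 → Exec B s t s' → Exec (.ite r A B) s (t + 1) s'
  | loop_done {r : ℕ} {A : Prog} {s : State} :
      s.reg r = 0 → Exec (.loop r A) s 1 s
  | loop_step {r : ℕ} {A : Prog} {s s' s'' : State} {t t' : ℕ} :
      s.reg r ≠ 0 → Exec A s t s' → Exec (.loop r A) s' t' s'' →
        Exec (.loop r A) s (t + t' + 1) s''

/-- The initial configuration on the input `L`: the list `L` is written at the start of the memory,
and everything else is `0`. -/
def init (L : List ℕ) : State where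
  reg := fun _ => 0
  mem := fun i => L.getD i 0

end RAM

/-! ### The discrete Colonel Blotto game -/

/-- An instance: `n` troops of player 1, `m` troops of player 2, and `k` battlefields with positive
integer weights. -/
structure Blotto where
  n : ℕ
  m : ℕ
  k : ℕ
  w : Fin k → ℕ
  w_pos : ∀ i, 0 < w i

namespace Blotto

/-- Pure strategies of a player who distributes at most `N` troops over `k` battlefields. -/
abbrev Pure (N k : ℕ) : Type := {x : Fin k → ℕ // ∑ i, x i ≤ N}

/-- The utility of player 1: the total weight of the battlefields where he has strictly more
troops than player 2. -/
def utility (G : Blotto) (x : Pure G.n G.k) (y : Pure G.m G.k) : ℕ :=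
  ∑ i with y.1 i < x.1 i, G.w i

/-- The probability that player 1 gets a utility of at least `u`, when the players independently
draw their pure strategies from the mixed strategies `σ` and `τ`. -/
noncomputable def winProb (G : Blotto) (u : ℝ) (σ : PMF (Pure G.n G.k)) (τ : PMF (Pure G.m G.k)) :
    ℝ≥0∞ :=
  (σ.bind fun x => τ.map fun y => (x, y)).toOuterMeasure {z | u ≤ (G.utility z.1 z.2 : ℝ)}

/-- `σ` is a `(u, p)`-maxmin strategy of player 1. -/
def IsMaxmin (G : Blotto) (u p : ℝ) (σ : PMF (Pure G.n G.k)) : Prop :=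
  ∀ τ : PMF (Pure G.m G.k), ENNReal.ofReal p ≤ G.winProb u σ τ

/-- `σ` is a `c`-strategy of player 1: its support has at most `c` elements. -/
def IsCStrategy (G : Blotto) (c : ℕ) (σ : PMF (Pure G.n G.k)) : Prop :=
  σ.support.encard ≤ c

/-! ### Input and output of an algorithm for the game -/

/-- The input: the instance together with the target utility `u` and the target probability `p`. -/
def encode (G : Blotto) (u p : ℚ≥0) : List ℕ :=
  [G.n, G.m, G.k, u.num, u.den, p.num, p.den] ++ List.ofFn G.w

/-- The size of the input: the numbers of troops and of battlefields count with their values, the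
weights and the numerators and denominators of `u` and `p` with their binary lengths. -/
def inputSize (G : Blotto) (u p : ℚ≥0) : ℕ :=
  G.n + G.m + G.k + ∑ i, (G.w i).size + u.num.size + u.den.size + p.num.size + p.den.size

/-- The memory of `s` describes the mixed strategy `σ` of player 1: it starts with numbers `a`, `b`
and the entries of two pure strategies `x`, `x'`, and `σ` plays `x` with probability `a / (a + b)`
and `x'` with probability `b / (a + b)` (these add up if `x = x'`). -/
def Outputs (G : Blotto) (s : RAM.State) (σ : PMF (Pure G.n G.k)) : Prop :=
  ∃ (a b : ℕ) (x x' : Pure G.n G.k),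
    s.mem 0 = a ∧ s.mem 1 = b ∧ 0 < a + b ∧
    (∀ i : Fin G.k, s.mem (2 + i) = x.1 i) ∧
    (∀ i : Fin G.k, s.mem (2 + G.k + i) = x'.1 i) ∧
    ∀ z, σ z = (if z = x then (a : ℝ≥0∞) / (a + b) else 0) +
      (if z = x' then (b : ℝ≥0∞) / (a + b) else 0)

end Blotto

/-!
The algorithm rounds a Lagrangian relaxation of the best response of player 2, with a multiplier
`N / D` for his troops.

*Reduction to pure strategies.* Let `U` be the target utility, rounded up. If `p ≤ 1 / 2`, a
`(u, p)`-maxmin 2-strategy provides two pure strategies `x`, `x'` such that one of them gets `U` against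
every `y`; conversely, playing such a pair with probabilities `1 / 2` is good enough. If `p > 1 / 2`, one
of the two pure strategies has to get `U` against every `y` on its own, so that the pair can be taken
with `x = x'` (`IsMaxmin.exists_pair`, `isMaxmin_half`, `isMaxmin_pure`).

*Relaxation.* Call a battlefield heavy if its weight is at least `U / 3`. A response `y` which keeps both
strategies below `U / 3` beats both of them on all heavy battlefields. So `price` bounds the contribution of
a battlefield to `D * (u(x, y) + u(x', y)) + N * ∑ y` from below for these `y`, and if the prices sum up to
at least `2 * U * D / 3 + N * m`, there is no such response within the budget `m`
(`le_gain_of_le_sum_price`).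

*Integrality gap.* Conversely, let one of `x`, `x'` get `U` against every `y`. Consider the smallest
candidate multiplier for which the cheapest best responses to the prices are affordable. There, the
best responses for the preceding candidate are optimal too, but not affordable. Switching from the
former to the latter one battlefield at a time, the budget is exceeded at some battlefield, which is
light since there is only one option on heavy ones. Just before that switch `x` or `x'` still gets `U`, so
just after it still gets more than `2 * U / 3`, and the Lagrangian bound is at least that large
(`exists_candidate`).

*Search.* For each of the polynomially many candidates, the strategies with the largest total price
are found by a dynamic program over the troops that remain for `x` and for `x'` (`best`). The weights are
scaled by a large power of `(n + 1) ^ 2`, so that the low digits of the optimum can record the choices that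
lead to it (`sum_entry`, `digit_sum_mul_pow`).

*Running time.* The number of steps is at most a polynomial in any bound `M` for the number of
iterations of each loop, which is read off from the program (`Prog.timeBound`). The weakest
preconditions `Wp` include this bound, so that it remains to see that each loop runs at most `M` times.
-/

/-! ### Running time and weakest preconditions -/

namespace RAM

open Polynomial in
/-- A bound for the running time of a program, as a polynomial in a bound for the number of iterations
of each of its loops. -/
noncomputable def Prog.timeBound : Prog → Polynomial ℕ
  | .skip => 1
  | .instr _ => 1
  | .seq A B => A.timeBound + B.timeBound
  | .ite _ A B => A.timeBound + B.timeBound + 1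
  | .loop _ A => X * (A.timeBound + 1) + 1

/-- The total weakest precondition of `Q` under `A`, with a time bound: started in `s`, the program
halts in a configuration with property `Q`, within the time in which it halts if every loop runs at
most `M` times. -/
def Wp (M : ℕ) (A : Prog) (Q : State → Prop) (s : State) : Prop :=
  ∃ t s', Exec A s t s' ∧ t ≤ A.timeBound.eval M ∧ Q s'

variable {M : ℕ} {A B : Prog} {Q Q' : State → Prop} {s : State}

theorem Wp.mono (h : Wp M A Q s) (hQ : ∀ s, Q s → Q' s) : Wp M A Q' s := by
  obtain ⟨t, s', h1, h2, h3⟩ := h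
  exact ⟨t, s', h1, h2, hQ _ h3⟩

theorem wp_skip (h : Q s) : Wp M .skip Q s :=
  ⟨1, s, .skip s, by simp [Prog.timeBound], h⟩

theorem wp_instr {c : Instr} (h : Q (c.run s)) : Wp M (.instr c) Q s :=
  ⟨1, _, .instr c s, by simp [Prog.timeBound], h⟩

theorem wp_seq (h : Wp M A (Wp M B Q) s) : Wp M (.seq A B) Q s := by
  obtain ⟨t, s', h1, h2, t', s'', h3, h4, h5⟩ := h
  exact ⟨t + t', s'', .seq h1 h3, by simp only [Prog.timeBound, Polynomial.eval_add]; omega, h5⟩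

theorem wp_ite {r : ℕ} (hA : s.reg r ≠ 0 → Wp M A Q s) (hB : s.reg r = 0 → Wp M B Q s) :
    Wp M (.ite r A B) Q s := by
  by_cases h : s.reg r = 0
  · obtain ⟨t, s', h1, h2, h3⟩ := hB h
    refine ⟨t + 1, s', .ite_false h h1, ?_, h3⟩
    simp only [Prog.timeBound, Polynomial.eval_add, Polynomial.eval_one]; omega
  · obtain ⟨t, s', h1, h2, h3⟩ := hA h
    refine ⟨t + 1, s', .ite_true h h1, ?_, h3⟩
    simp only [Prog.timeBound, Polynomial.eval_add, Polynomial.eval_one]; omega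

/-- Straight-line code. -/
def block : List Instr → Prog
  | [] => .skip
  | c :: l => .seq (.instr c) (block l)

theorem wp_block {l : List Instr} (h : Q (l.foldl (fun s c => c.run s) s)) :
    Wp M (block l) Q s := by
  induction l generalizing s with
  | nil => exact wp_skip h
  | cons c l ih => exact wp_seq (wp_instr (ih h))

/-- The register that an instruction writes, if any, is not `r`. -/
def Instr.keeps (r : ℕ) : Instr → Bool
  | .const r' _ | .add r' _ _ | .sub r' _ _ | .div r' _ _ | .mod r' _ _ | .load r' _ =>
    decide (r ≠ r')
  | .store _ _ => true

/-- No instruction of the program writes the register `r`. -/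
def Prog.keeps (r : ℕ) : Prog → Bool
  | .skip => true
  | .instr c => c.keeps r
  | .seq A B | .ite _ A B => A.keeps r && B.keeps r
  | .loop _ A => A.keeps r

theorem Exec.reg_eq {t : ℕ} {s' : State} {r : ℕ} (h : Exec A s t s') (hr : A.keeps r = true) :
    s'.reg r = s.reg r := by
  induction h with
  | skip s => rfl
  | instr c s =>
    cases c <;> simp_all [Prog.keeps, Instr.keeps, Instr.run]
  | seq _ _ ih1 ih2 => simp_all [Prog.keeps]
  | ite_true _ _ ih => simp_all [Prog.keeps]
  | ite_false _ _ ih => simp_all [Prog.keeps]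
  | loop_done _ => rfl
  | loop_step _ _ _ ih1 ih2 => simp_all [Prog.keeps]

theorem Wp.frame (h : Wp M A Q s) :
    Wp M A (fun s' => Q s' ∧ ∀ r, A.keeps r = true → s'.reg r = s.reg r) s := by
  obtain ⟨t, s', h1, h2, h3⟩ := h
  exact ⟨t, s', h1, h2, h3, fun r hr => h1.reg_eq hr⟩

/-- Run `A` with `reg i = 0, 1, …, reg N - 1`; the register `t` is used for the loop test. -/
def forLoop (i t N : ℕ) (A : Prog) : Prog :=
  .seq (block [.const i 0, .sub t N i])
    (.loop t (.seq A (block [.const t 1, .add i i t, .sub t N i])))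

/-- The rule for `forLoop`: `I j` is an invariant, which holds before round `j`. The registers that
the loop does not write keep their values from the start of the loop. -/
theorem wp_forLoop {i t N : ℕ} (I : ℕ → State → Prop) (hiA : A.keeps i = true)
    (hNA : (forLoop i t N A).keeps N = true) (hit : i ≠ t) (hM : s.reg N ≤ M)
    (h0 : I 0 { s with reg := Function.update (Function.update s.reg i 0) t (s.reg N) })
    (hstep : ∀ j < s.reg N, ∀ s' : State, s'.reg i = j →
      (∀ r, (forLoop i t N A).keeps r = true → s'.reg r = s.reg r) → I j s' →
      Wp M A (fun s'' => I (j + 1) { s'' with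
        reg := Function.update (Function.update s''.reg i (j + 1)) t (s.reg N - (j + 1)) }) s')
    (hQ : ∀ s' : State, (∀ r, (forLoop i t N A).keeps r = true → s'.reg r = s.reg r) →
      I (s.reg N) s' → Q s') :
    Wp M (forLoop i t N A) Q s := by
  have hkeep : ∀ r, (forLoop i t N A).keeps r = true ↔ A.keeps r = true ∧ r ≠ i ∧ r ≠ t := by
    intro r
    simp [forLoop, block, Prog.keeps, Instr.keeps]
    tauto
  have hN := (hkeep N).1 hNA
  have key : ∀ c, ∀ j, ∀ s' : State, j + c = s.reg N → s'.reg i = j → s'.reg t = c →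
      (∀ r, (forLoop i t N A).keeps r = true → s'.reg r = s.reg r) → I j s' →
      ∃ u s'', Exec (.loop t (.seq A (block [.const t 1, .add i i t, .sub t N i]))) s' u s'' ∧
        u ≤ c * (A.timeBound.eval M + 5) + 1 ∧
        (∀ r, (forLoop i t N A).keeps r = true → s''.reg r = s.reg r) ∧ I (s.reg N) s'' := by
    intro c
    induction c with
    | zero =>
      intro j s' hj hi ht hf hI
      refine ⟨1, s', .loop_done ht, by omega, hf, ?_⟩
      have : j = s.reg N := by omega
      exact this ▸ hI
    | succ c ih =>
      intro j s' hj hi ht hf hI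
      obtain ⟨u, s1, h1, h2, h3, h4⟩ := (hstep j (by omega) s' hi hf hI).frame
      have hs1i : s1.reg i = j := by rw [h4 i hiA, hi]
      have hs1N : s1.reg N = s.reg N := by rw [h4 N hN.1, hf N hNA]
      set s2 : State := { s1 with
        reg := Function.update (Function.update s1.reg i (j + 1)) t (s.reg N - (j + 1)) } with hs2
      have hb : Exec (block [.const t 1, .add i i t, .sub t N i]) s1 4 s2 := by
        have e : s2 = (Instr.sub t N i).run ((Instr.add i i t).run ((Instr.const t 1).run s1)) := by
          simp only [Instr.run, hs2]
          congr 1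
          funext r
          by_cases hrt : r = t
          · subst hrt; simp [hit, hs1i, hN.2.1, hN.2.2, hs1N]
          · by_cases hri : r = i
            · subst hri; simp [hit, hs1i]
            · simp [hrt, hri]
        rw [e]
        exact .seq (t := 1) (t' := 3) (.instr _ _)
          (.seq (t := 1) (t' := 2) (.instr _ _) (.seq (t := 1) (t' := 1) (.instr _ _) (.skip _)))
      obtain ⟨v, s3, h5, h6, h7, h8⟩ := ih (j + 1) s2 (by omega)
        (by simp [hs2, hit]) (by simp [hs2]; omega)
        (by
          intro r hr
          have := (hkeep r).1 hr
          rw [← hf r hr, ← h4 r this.1]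
          simp [hs2, this.2.1, this.2.2]) h3
      refine ⟨_, s3, .loop_step (by omega) (.seq h1 hb) h5, ?_, h7, h8⟩
      rw [Nat.succ_mul]
      omega
  have hb : Exec (block [.const i 0, .sub t N i]) s 3
      { s with reg := Function.update (Function.update s.reg i 0) t (s.reg N) } := by
    have e : ({ s with reg := Function.update (Function.update s.reg i 0) t (s.reg N) } : State) =
        (Instr.sub t N i).run ((Instr.const i 0).run s) := by
      simp [Instr.run, hN.2.1]
    rw [e]
    exact .seq (t := 1) (t' := 2) (.instr _ _) (.seq (t := 1) (t' := 1) (.instr _ _) (.skip _))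
  obtain ⟨u, s', h1, h2, h3, h4⟩ := key (s.reg N) 0
    { s with reg := Function.update (Function.update s.reg i 0) t (s.reg N) } (by omega)
    (by simp [hit]) (by simp)
    (by
      intro r hr
      have := (hkeep r).1 hr
      simp [this.2.1, this.2.2]) h0
  refine ⟨_, s', .seq hb h1, ?_, hQ s' h3 h4⟩
  have hle : s.reg N * (A.timeBound.eval M + 5) ≤ M * (A.timeBound.eval M + 5) :=
    Nat.mul_le_mul_right _ hM
  simp only [forLoop, block, Prog.timeBound, Polynomial.eval_add, Polynomial.eval_mul,
    Polynomial.eval_X, Polynomial.eval_one]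
  have : A.timeBound.eval M + (1 + (1 + (1 + 1))) + 1 = A.timeBound.eval M + 5 := by ring
  rw [this]
  omega

/-! ### Multiplication by small numbers -/

/-- `reg r := reg a * reg b` by repeated addition, in time linear in `reg b`. -/
def mul (r a b : ℕ) : Prog :=
  .seq (.instr (.const r 0)) (forLoop 60 61 b (.instr (.add r r a)))

theorem wp_mul {r a b : ℕ} (hr : r < 60) (ha : a < 60) (hb : b < 60) (hra : r ≠ a) (hrb : r ≠ b)
    (hM : s.reg b ≤ M)
    (h : ∀ f : ℕ → ℕ, f r = s.reg a * s.reg b → (∀ x < 60, x ≠ r → f x = s.reg x) → Q ⟨f, s.mem⟩) :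
    Wp M (mul r a b) Q s := by
  have hkeep : ∀ x < 60, x ≠ r → (forLoop 60 61 b (.instr (.add r r a))).keeps x = true := by
    intro x hx hxr
    simp [forLoop, block, Prog.keeps, Instr.keeps, hxr]
    omega
  refine wp_seq (wp_instr ?_)
  refine wp_forLoop (fun j s' => s'.reg r = s.reg a * j ∧ s'.mem = s.mem)
    (by simp [Prog.keeps, Instr.keeps]; omega) (hkeep b hb (Ne.symm hrb)) (by decide)
    (by simpa [Instr.run, Ne.symm hrb] using hM) ?_ ?_ ?_
  · have h1 : r ≠ 61 := by omega
    have h2 : r ≠ 60 := by omega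
    simp [Instr.run, h1, h2]
  · rintro j - s' hj hf ⟨h1, h2⟩
    have h3 : r ≠ 61 := by omega
    have h4 : r ≠ 60 := by omega
    have h5 := hf a (hkeep a ha (Ne.symm hra))
    refine wp_instr ?_
    simp [Instr.run, h3, h4, h1, h2, h5, Ne.symm hra, Nat.mul_succ]
  · rintro ⟨f, mem⟩ hf ⟨h1, h2⟩
    simp only [Instr.run] at h1 h2 hf
    subst h2
    refine h f (by simpa [Ne.symm hrb] using h1) fun x hx hxr => ?_
    simpa [hxr] using hf x (hkeep x hx hxr)

/-- `reg r := reg r * reg b ^ reg c`, in time linear in `reg b * reg c`. -/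
def mulPow (r b c : ℕ) : Prog :=
  forLoop 50 51 c (.seq (mul 52 r b) (block [.const 53 0, .add r 52 53]))

theorem wp_mulPow {r b c : ℕ} (hr : r < 50) (hb : b < 50) (hc : c < 50) (hrb : r ≠ b) (hrc : r ≠ c)
    (hMb : s.reg b ≤ M) (hMc : s.reg c ≤ M)
    (h : ∀ f : ℕ → ℕ, f r = s.reg r * s.reg b ^ s.reg c → (∀ x < 50, x ≠ r → f x = s.reg x) →
      Q ⟨f, s.mem⟩) :
    Wp M (mulPow r b c) Q s := by
  have hkeep : ∀ x < 50, x ≠ r → (mulPow r b c).keeps x = true := by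
    intro x hx hxr
    simp [mulPow, mul, forLoop, block, Prog.keeps, Instr.keeps, hxr]
    omega
  refine wp_forLoop (fun j s' => s'.reg r = s.reg r * s.reg b ^ j ∧ s'.mem = s.mem)
    (by simp [mul, forLoop, block, Prog.keeps, Instr.keeps]; omega) (hkeep c hc (Ne.symm hrc))
    (by decide) hMc ?_ ?_ ?_
  · have h1 : r ≠ 51 := by omega
    have h2 : r ≠ 50 := by omega
    simp [h1, h2]
  · rintro j - s' hj hf ⟨h1, h2⟩
    have h3 : r ≠ 51 := by omega
    have h4 : r ≠ 50 := by omega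
    have h5 := hf b (hkeep b hb (Ne.symm hrb))
    refine wp_seq (wp_mul (by omega) (by omega) (by omega) (by omega) (by omega) (h5 ▸ hMb) ?_)
    intro f hf1 hf2
    refine wp_block ?_
    simp [Instr.run, h3, h4, hf1, h1, h5, h2, pow_succ, mul_assoc]
  · rintro ⟨f, mem⟩ hf ⟨h1, h2⟩
    simp only at h1 h2 hf
    subst h2
    exact h f h1 fun x hx hxr => hf x (hkeep x hx hxr)

end RAM

/-! ### Lagrangian relaxation of the best response to two strategies -/

namespace Blotto

/-- The total utility of two strategies on a battlefield of weight `w` to which they assign `a` and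
`b` troops, against `y` troops. -/
def kept (w a b y : ℕ) : ℕ := (if y < a then w else 0) + if y < b then w else 0

/-- The minimum of `D * kept w a b y + N * y` over all `y` on a light battlefield (`3 * w < U`), where
`y` only has to be compared for `max a b`, `min a b` and `0`, and over `max a b ≤ y` on a heavy one. -/
def price (N D U w a b : ℕ) : ℕ :=
  if U ≤ 3 * w then N * max a b else min (min (N * max a b) (D * w + N * min a b)) (D * w + D * w)

theorem price_le_of_light {N D U w a b : ℕ} (hw : 3 * w < U) (y : ℕ) :
    price N D U w a b ≤ D * kept w a b y + N * y := by
  rw [price, if_neg (by omega), kept]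
  by_cases ha : y < a <;> by_cases hb : y < b
  · simp only [ha, hb, if_true]
    refine (min_le_right _ _).trans ?_
    rw [Nat.mul_add]; omega
  · refine (min_le_left _ _).trans ((min_le_right _ _).trans ?_)
    simp only [ha, hb, if_true, if_false, add_zero]
    have := Nat.mul_le_mul_left N (show min a b ≤ y by omega)
    omega
  · refine (min_le_left _ _).trans ((min_le_right _ _).trans ?_)
    simp only [ha, hb, if_true, if_false, zero_add]
    have := Nat.mul_le_mul_left N (show min a b ≤ y by omega)
    omega
  · refine (min_le_left _ _).trans ((min_le_left _ _).trans ?_)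
    have := Nat.mul_le_mul_left N (show max a b ≤ y by omega)
    omega

theorem price_le_of_heavy {N D U w a b y : ℕ} (hw : U ≤ 3 * w) (hy : max a b ≤ y) :
    price N D U w a b ≤ D * kept w a b y + N * y := by
  rw [price, if_pos hw]
  have := Nat.mul_le_mul_left N hy
  omega

variable {ι : Type*} [Fintype ι]

/-- The total weight of the battlefields where `x` beats `y`. -/
def gain (w x y : ι → ℕ) : ℕ := ∑ i with y i < x i, w i

theorem gain_add_gain (w x x' y : ι → ℕ) :
    gain w x y + gain w x' y = ∑ i, kept (w i) (x i) (x' i) (y i) := by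
  simp only [gain, kept, Finset.sum_filter, Finset.sum_add_distrib]

/-- If the Lagrangian lower bound is large enough, one of the two strategies gets `U / 3` against
every strategy of the opponent. -/
theorem le_gain_of_le_sum_price {w x x' : ι → ℕ} {N D U m : ℕ} (hD : 0 < D)
    (h : 2 * U * D + 3 * N * m ≤ 3 * ∑ i, price N D U (w i) (x i) (x' i)) (y : ι → ℕ)
    (hy : ∑ i, y i ≤ m) : U ≤ 3 * gain w x y ∨ U ≤ 3 * gain w x' y := by
  by_contra! hc
  have hle : ∀ i, price N D U (w i) (x i) (x' i) ≤ D * kept (w i) (x i) (x' i) (y i) + N * y i := by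
    intro i
    by_cases hw : U ≤ 3 * w i
    · have aux : ∀ x : ι → ℕ, 3 * gain w x y < U → x i ≤ y i := by
        intro x hx
        by_contra! hlt
        have : w i ≤ gain w x y :=
          Finset.single_le_sum (f := w) (fun _ _ => Nat.zero_le _) (by simpa using hlt)
        omega
      exact price_le_of_heavy hw (max_le (aux x hc.1) (aux x' hc.2))
    · exact price_le_of_light (by omega) _
  have hsum : ∑ i, price N D U (w i) (x i) (x' i) ≤
      D * (gain w x y + gain w x' y) + N * ∑ i, y i := by
    rw [gain_add_gain, Finset.mul_sum, Finset.mul_sum, ← Finset.sum_add_distrib]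
    exact Finset.sum_le_sum fun i _ => hle i
  nlinarith [Nat.mul_le_mul_left N hy]

/-- The troop numbers that the opponent of the strategies `a`, `b` has to consider on a battlefield:
on a heavy battlefield he has to beat both strategies. -/
def options (U w a b : ℕ) : Finset ℕ := if U ≤ 3 * w then {max a b} else {0, min a b, max a b}

theorem exists_option_le_price {N D U w a b : ℕ} :
    ∃ y ∈ options U w a b, D * kept w a b y + N * y ≤ price N D U w a b := by
  unfold options price
  split_ifs with h
  · exact ⟨max a b, by simp, by simp [kept]⟩
  · rcases min_choice (min (N * max a b) (D * w + N * min a b)) (D * w + D * w) with h1 | h1 <;>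
      rw [h1]
    · rcases min_choice (N * max a b) (D * w + N * min a b) with h2 | h2 <;> rw [h2]
      · exact ⟨max a b, by simp, by simp [kept]⟩
      · refine ⟨min a b, by simp, Nat.add_le_add_right (Nat.mul_le_mul_left _ ?_) _⟩
        unfold kept
        split_ifs <;> omega
    · refine ⟨0, by simp, ?_⟩
      rw [mul_zero, add_zero, ← Nat.mul_add]
      refine Nat.mul_le_mul_left _ ?_
      unfold kept
      split_ifs <;> omega

theorem options_nonempty (U w a b : ℕ) : (options U w a b).Nonempty := by
  unfold options
  split_ifs <;> simp

theorem le_of_mem_options {U w a b y n : ℕ} (hy : y ∈ options U w a b) (ha : a ≤ n) (hb : b ≤ n) :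
    y ≤ n := by
  unfold options at hy
  split_ifs at hy <;> simp at hy <;> omega

/-- The value of the option `y` for the multiplier `l`. -/
def lagr (l : ℚ) (w a b y : ℕ) : ℚ := kept w a b y + l * y

/-- There is a best option for the multiplier `l`, and a smallest one among these. -/
theorem exists_best_option (l : ℚ) (U w a b : ℕ) : ∃ y ∈ options U w a b,
    ∀ z ∈ options U w a b, lagr l w a b y ≤ lagr l w a b z ∧
      (lagr l w a b y = lagr l w a b z → y ≤ z) := by
  obtain ⟨y, hy, h⟩ := (options U w a b).exists_min_image
    (fun y => toLex (lagr l w a b y, y)) (options_nonempty U w a b)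
  refine ⟨y, hy, fun z hz => ?_⟩
  rcases Prod.Lex.le_iff.1 (h z hz) with h1 | h1
  · exact ⟨h1.le, fun h2 => absurd h2 h1.ne⟩
  · exact ⟨h1.1.le, fun _ => h1.2⟩

/-- The multipliers at which the best options can change, if `V` contains all weights, and some others.
Such a multiplier is `w / e` or `2 * w / e` with `1 ≤ e ≤ n`, which is of the form `2 * w / (d + 1)` in
either case. -/
def candidates (V : Finset ℕ) (n : ℕ) : Finset ℚ :=
  insert 0 ((V ×ˢ Finset.range (2 * (n + 1))).image fun v => 2 * (v.1 : ℚ) / (v.2 + 1 : ℕ))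

theorem kept_sub_mem {w a b y z : ℕ} (h : kept w a b y < kept w a b z) :
    kept w a b z - kept w a b y = w ∨ kept w a b z - kept w a b y = 2 * w := by
  unfold kept at *
  split_ifs at * <;> omega

/-- A smallest best option for a multiplier `l` is still a best option for the next candidate. -/
theorem lagr_le_of_no_candidate {l l' : ℚ} {w a b n y z : ℕ} {V : Finset ℕ} (hwV : w ∈ V)
    (hy : y ≤ n) (hl : 0 ≤ l) (hll : l < l')
    (hgap : ∀ c ∈ candidates V n, l < c → l' ≤ c)
    (h1 : lagr l w a b y ≤ lagr l w a b z) (h2 : lagr l w a b y = lagr l w a b z → y ≤ z) :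
    lagr l' w a b y ≤ lagr l' w a b z := by
  by_contra! hc
  have hzy : (z : ℚ) < y := by
    unfold lagr at *
    by_contra! hle
    nlinarith [mul_le_mul_of_nonneg_left hle (sub_nonneg.2 hll.le)]
  have hzy' : z < y := by exact_mod_cast hzy
  have hlt : lagr l w a b y < lagr l w a b z := lt_of_le_of_ne h1 fun h => by have := h2 h; omega
  -- the two values agree at a candidate strictly between `l` and `l'`
  have hd : (0 : ℚ) < y - z := by linarith
  set c : ℚ := ((kept w a b z : ℚ) - kept w a b y) / (y - z) with hcdef
  have hlc : l < c := by
    rw [hcdef, lt_div_iff₀ hd]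
    unfold lagr at hlt
    linarith
  have hcl : c < l' := by
    rw [hcdef, div_lt_iff₀ hd]
    unfold lagr at hc
    linarith
  have hk : kept w a b y < kept w a b z := by
    have : (0 : ℚ) < kept w a b z - kept w a b y := by
      have := (lt_div_iff₀ hd).1 (hl.trans_lt hlc)
      linarith
    exact_mod_cast sub_pos.1 this
  refine absurd (hgap c ?_ hlc) (not_le.2 hcl)
  have hcast : ((kept w a b z : ℚ) - kept w a b y) = ((kept w a b z - kept w a b y : ℕ) : ℚ) := by
    rw [Nat.cast_sub hk.le]
  have hcast' : (y : ℚ) - z = ((y - z : ℕ) : ℚ) := by rw [Nat.cast_sub hzy'.le]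
  have hne : ((y - z : ℕ) : ℚ) ≠ 0 := by rw [← hcast']; exact hd.ne'
  unfold candidates
  refine Finset.mem_insert_of_mem (Finset.mem_image.2 ?_)
  rcases kept_sub_mem hk with h | h
  · refine ⟨(w, 2 * (y - z) - 1), by simp [hwV]; omega, ?_⟩
    rw [hcdef, hcast, hcast', h]
    have : 2 * (y - z) - 1 + 1 = 2 * (y - z) := by omega
    simp only [this]
    push_cast
    field_simp
  · refine ⟨(w, y - z - 1), by simp [hwV]; omega, ?_⟩
    rw [hcdef, hcast, hcast', h]
    have : y - z - 1 + 1 = y - z := by omega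
    simp only [this]
    push_cast
    ring

/-- A property of sets that holds for `∅` and fails for the whole type is lost at some element. -/
theorem exists_insert_of_univ [DecidableEq ι] (P : Finset ι → Prop) (h0 : P ∅)
    (h1 : ¬ P Finset.univ) : ∃ T j, j ∉ T ∧ P T ∧ ¬ P (insert j T) := by
  by_contra! h
  refine h1 (Finset.induction_on Finset.univ h0 fun j T hj hT => h T j hj hT)

/-- If one of two strategies gets `U` against every strategy of the opponent, then the Lagrangian
bound reaches `2 * U / 3` for some candidate multiplier. -/
theorem exists_candidate {w x x' : ι → ℕ} {U m n : ℕ} {V : Finset ℕ} (hV : ∀ i, w i ∈ V)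
    (hU : U ∈ V) (hx : ∀ i, x i ≤ n) (hx' : ∀ i, x' i ≤ n)
    (h : ∀ y : ι → ℕ, ∑ i, y i ≤ m → U ≤ gain w x y ∨ U ≤ gain w x' y) :
    ∃ v ∈ V, ∃ d < 2 * (n + 1), 2 * U * (d + 1) + 3 * (2 * v) * m ≤
      3 * ∑ i, price (2 * v) (d + 1) U (w i) (x i) (x' i) := by
  classical
  rcases Nat.eq_zero_or_pos U with rfl | hU0
  · exact ⟨0, hU, 0, by omega, by simp⟩
  by_cases hheavy : m < ∑ i with U ≤ 3 * w i, max (x i) (x' i)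
  · -- with the multiplier `2 * U`, already one missing troop on the heavy battlefields costs enough
    refine ⟨U, hU, 0, by omega, ?_⟩
    have : 2 * U * ∑ i with U ≤ 3 * w i, max (x i) (x' i) ≤
        ∑ i, price (2 * U) (0 + 1) U (w i) (x i) (x' i) := by
      rw [Finset.mul_sum, Finset.sum_filter]
      refine Finset.sum_le_sum fun i _ => ?_
      split_ifs with hi
      · rw [price, if_pos hi]
      · exact Nat.zero_le _
    have h2 := Nat.mul_le_mul_left (2 * U) (Nat.succ_le_of_lt hheavy)
    rw [Nat.mul_succ] at h2
    nlinarith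
  -- the smallest best options for each multiplier
  choose o ho1 ho2 using fun (l : ℚ) (i : ι) => exists_best_option l U (w i) (x i) (x' i)
  -- for the multiplier `2 * U` it is best to give up the light battlefields
  have hlarge : ∑ i, o (2 * U) i ≤ m := by
    refine le_trans (le_of_eq ?_) (not_lt.1 hheavy)
    rw [Finset.sum_filter]
    refine Finset.sum_congr rfl fun i _ => ?_
    have h1 := ho1 (2 * U) i
    split_ifs with hi
    · simpa [options, hi] using h1
    · obtain ⟨h2, -⟩ := ho2 (2 * U) i 0 (by simp [options, hi])
      by_contra hne
      have h3 : (1 : ℚ) ≤ o (2 * U) i := by exact_mod_cast Nat.one_le_iff_ne_zero.2 hne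
      have h4 : kept (w i) (x i) (x' i) 0 < U := by unfold kept; split_ifs <;> omega
      have h5 : (kept (w i) (x i) (x' i) 0 : ℚ) < U := by exact_mod_cast h4
      have h6 : (0 : ℚ) < U := by exact_mod_cast hU0
      unfold lagr at h2
      have h7 : (0 : ℚ) ≤ (kept (w i) (x i) (x' i) (o (2 * U) i) : ℚ) := Nat.cast_nonneg _
      push_cast at h2
      nlinarith
  -- for the multiplier `0` it is best to win everything, which leaves nothing to player 1
  have hzero : m < ∑ i, o 0 i := by
    by_contra! hle
    have hk : ∀ i, kept (w i) (x i) (x' i) (o 0 i) = 0 := by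
      intro i
      obtain ⟨h2, -⟩ := ho2 0 i (max (x i) (x' i)) (by unfold options; split_ifs <;> simp)
      have h3 : kept (w i) (x i) (x' i) (max (x i) (x' i)) = 0 := by simp [kept]
      simp only [lagr, h3, zero_mul, add_zero] at h2
      exact Nat.le_zero.1 (by exact_mod_cast h2)
    have := gain_add_gain w x x' (o 0)
    rw [Finset.sum_eq_zero fun i _ => hk i] at this
    have := h (o 0) hle
    omega
  -- `l'` is the smallest candidate with affordable best options, `l` the candidate before it
  have hnn : ∀ c ∈ candidates V n, 0 ≤ c := by
    intro c hc
    rcases Finset.mem_insert.1 hc with rfl | hc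
    · exact le_rfl
    · obtain ⟨v, -, rfl⟩ := Finset.mem_image.1 hc
      positivity
  obtain ⟨l', hl', hmin⟩ := Finset.exists_min_image
    ((candidates V n).filter fun l => ∑ i, o l i ≤ m) id
    ⟨2 * U, by
      refine Finset.mem_filter.2 ⟨Finset.mem_insert_of_mem (Finset.mem_image.2 ⟨(U, 0), ?_, ?_⟩), hlarge⟩
      · simp [hU]
      · simp⟩
  obtain ⟨hl'c, hl'm⟩ := Finset.mem_filter.1 hl'
  have hl'0 : 0 < l' := lt_of_le_of_ne (hnn l' hl'c) (by rintro rfl; omega)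
  obtain ⟨l, hl, hmax⟩ := Finset.exists_max_image ((candidates V n).filter fun l => l < l') id
    ⟨0, Finset.mem_filter.2 ⟨Finset.mem_insert_self _ _, hl'0⟩⟩
  obtain ⟨hlc, hll'⟩ := Finset.mem_filter.1 hl
  have hlm : m < ∑ i, o l i := by
    by_contra! hle
    exact absurd (hmin l (Finset.mem_filter.2 ⟨hlc, hle⟩)) (not_le.2 hll')
  have hgap : ∀ c ∈ candidates V n, l < c → l' ≤ c := by
    intro c hc hlc
    by_contra! hcl
    exact absurd (hmax c (Finset.mem_filter.2 ⟨hc, hcl⟩)) (not_le.2 hlc)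
  have hbest : ∀ i, ∀ z ∈ options U (w i) (x i) (x' i),
      lagr l' (w i) (x i) (x' i) (o l i) ≤ lagr l' (w i) (x i) (x' i) z := fun i z hz =>
    lagr_le_of_no_candidate (hV i) (le_of_mem_options (ho1 l i) (hx i) (hx' i)) (hnn l hlc)
      hll' hgap (ho2 l i z hz).1 (ho2 l i z hz).2
  -- switch from `o l'` to `o l`, one battlefield at a time, until the costs exceed `m`
  let hyb : Finset ι → ι → ℕ := fun T i => if i ∈ T then o l i else o l' i
  obtain ⟨T, j, hjT, hT, hjm⟩ := exists_insert_of_univ (fun T => ∑ i, hyb T i ≤ m)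
    (by simpa [hyb] using hl'm) (by simpa [hyb] using hlm)
  have hsame : ∀ i, i ≠ j → hyb (insert j T) i = hyb T i := by
    intro i hi
    simp [hyb, hi]
  have hlight : 3 * w j < U := by
    by_contra! hj
    refine hjm (le_of_eq_of_le (Finset.sum_congr rfl fun i _ => ?_) hT)
    by_cases hij : i = j
    · subst hij
      have h1 := ho1 l i
      have h2 := ho1 l' i
      simp only [options, hj, if_true, Finset.mem_singleton] at h1 h2
      simp [hyb, hjT, h1, h2]
    · exact hsame i hij
  have hafter : ∀ x : ι → ℕ, gain w x (hyb T) ≤ gain w x (hyb (insert j T)) + w j := by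
    intro x
    have : (Finset.univ.filter fun i => hyb T i < x i) ⊆
        insert j (Finset.univ.filter fun i => hyb (insert j T) i < x i) := by
      intro i hi
      by_cases hij : i = j
      · simp [hij]
      · refine Finset.mem_insert_of_mem ?_
        simpa [hsame i hij] using hi
    refine (Finset.sum_le_sum_of_subset this).trans ?_
    unfold gain
    by_cases hj : j ∈ Finset.univ.filter fun i => hyb (insert j T) i < x i
    · rw [Finset.insert_eq_of_mem hj]; omega
    · rw [Finset.sum_insert hj]; omega
  have hkept : U ≤ ∑ i, kept (w i) (x i) (x' i) (hyb (insert j T) i) + w j := by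
    rw [← gain_add_gain]
    have h1 := hafter x
    have h2 := hafter x'
    have := h (hyb T) hT
    omega
  rcases Finset.mem_insert.1 hl'c with rfl | hl'c
  · exact absurd hl'0 (lt_irrefl _)
  obtain ⟨⟨v, d⟩, hvd, hvl⟩ := Finset.mem_image.1 hl'c
  rw [Finset.mem_product, Finset.mem_range] at hvd
  refine ⟨v, hvd.1, d, hvd.2, ?_⟩
  have hprice : ∀ i, (d + 1) * kept (w i) (x i) (x' i) (hyb (insert j T) i) +
      2 * v * hyb (insert j T) i ≤ price (2 * v) (d + 1) U (w i) (x i) (x' i) := by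
    intro i
    obtain ⟨z, hz, hle⟩ := exists_option_le_price (N := 2 * v) (D := d + 1) (U := U) (w := w i)
      (a := x i) (b := x' i)
    refine le_trans ?_ hle
    have h1 : lagr l' (w i) (x i) (x' i) (hyb (insert j T) i) ≤ lagr l' (w i) (x i) (x' i) z := by
      by_cases hi : i ∈ insert j T
      · simpa only [hyb, hi, if_true] using hbest i z hz
      · simpa only [hyb, hi, if_false] using (ho2 l' i z hz).1
    have hd : (0 : ℚ) < (d + 1 : ℕ) := by positivity
    have h2 := mul_le_mul_of_nonneg_left h1 hd.le
    have hmul : ∀ y : ℕ, ((d + 1 : ℕ) : ℚ) * lagr l' (w i) (x i) (x' i) y =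
        (((d + 1) * kept (w i) (x i) (x' i) y + 2 * v * y : ℕ) : ℚ) := by
      intro y
      rw [lagr, ← hvl]
      push_cast at hd ⊢
      field_simp
    rw [hmul, hmul] at h2
    exact_mod_cast h2
  have hsum := Finset.sum_le_sum fun i (_ : i ∈ Finset.univ) => hprice i
  rw [Finset.sum_add_distrib, ← Finset.mul_sum, ← Finset.mul_sum] at hsum
  have h3 := Nat.mul_le_mul_left (2 * v) (not_le.1 hjm).le
  have h4 : (d + 1) * (2 * U) ≤
      (d + 1) * (3 * ∑ i, kept (w i) (x i) (x' i) (hyb (insert j T) i)) :=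
    Nat.mul_le_mul_left _ (by omega)
  nlinarith

end Blotto

/-! ### Dynamic programming -/

namespace Blotto

/-- The largest value of `∑ i < k, g i (q i)` under the constraints `q i < B * B`,
`∑ i < k, q i / B ≤ a` and `∑ i < k, q i % B ≤ b`, by the recursion of a dynamic program. -/
def best (B : ℕ) (g : ℕ → ℕ → ℕ) : ℕ → ℕ → ℕ → ℕ
  | 0, _, _ => 0
  | i + 1, a, b => ((Finset.range (B * B)).filter fun q => q / B ≤ a ∧ q % B ≤ b).sup
      fun q => best B g i (a - q / B) (b - q % B) + g i q

variable {B : ℕ} {g : ℕ → ℕ → ℕ}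

theorem sum_le_best {k a b : ℕ} {q : ℕ → ℕ} (hq : ∀ i < k, q i < B * B)
    (ha : ∑ i ∈ Finset.range k, q i / B ≤ a) (hb : ∑ i ∈ Finset.range k, q i % B ≤ b) :
    ∑ i ∈ Finset.range k, g i (q i) ≤ best B g k a b := by
  induction k generalizing a b with
  | zero => simp
  | succ k ih =>
    rw [Finset.sum_range_succ] at ha hb ⊢
    refine le_trans (Nat.add_le_add_right (ih (fun i hi => hq i (by omega))
      (Nat.le_sub_of_add_le ha) (Nat.le_sub_of_add_le hb)) _) ?_
    exact Finset.le_sup (f := fun q => best B g k (a - q / B) (b - q % B) + g k q)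
      (Finset.mem_filter.2 ⟨Finset.mem_range.2 (hq k (by omega)), by omega, by omega⟩)

theorem exists_sum_eq_best (hB : 0 < B) (k a b : ℕ) : ∃ q : ℕ → ℕ, (∀ i, q i < B * B) ∧
    ∑ i ∈ Finset.range k, q i / B ≤ a ∧ ∑ i ∈ Finset.range k, q i % B ≤ b ∧
    ∑ i ∈ Finset.range k, g i (q i) = best B g k a b := by
  have hBB : 0 < B * B := Nat.mul_pos hB hB
  induction k generalizing a b with
  | zero => exact ⟨fun _ => 0, fun _ => hBB, by simp, by simp, by simp [best]⟩
  | succ k ih =>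
    obtain ⟨c, hc, hcs⟩ := Finset.exists_mem_eq_sup
      ((Finset.range (B * B)).filter fun q => q / B ≤ a ∧ q % B ≤ b)
      ⟨0, by simp [hBB]⟩ (fun q => best B g k (a - q / B) (b - q % B) + g k q)
    simp only [Finset.mem_filter, Finset.mem_range] at hc
    obtain ⟨q, h1, h2, h3, h4⟩ := ih (a - c / B) (b - c % B)
    have hlt : ∀ f : ℕ → ℕ → ℕ, ∑ i ∈ Finset.range k, f i (Function.update q k c i) =
        ∑ i ∈ Finset.range k, f i (q i) := fun f => Finset.sum_congr rfl fun i hi => by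
      rw [Function.update_of_ne (Finset.mem_range.1 hi).ne]
    refine ⟨Function.update q k c, fun i => ?_, ?_, ?_, ?_⟩
    · by_cases hi : i = k
      · subst hi; simpa using hc.1
      · simpa [hi] using h1 i
    · rw [Finset.sum_range_succ, hlt fun _ q => q / B, Function.update_self]; omega
    · rw [Finset.sum_range_succ, hlt fun _ q => q % B, Function.update_self]; omega
    · rw [Finset.sum_range_succ, hlt, Function.update_self, h4, best, hcs]

/-- The largest value over the first `t` choices in the recursion for `best`. -/
def partialBest (B : ℕ) (g : ℕ → ℕ → ℕ) (i a b t : ℕ) : ℕ :=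
  ((Finset.range t).filter fun q => q / B ≤ a ∧ q % B ≤ b).sup
    fun q => best B g i (a - q / B) (b - q % B) + g i q

theorem partialBest_succ (i a b t : ℕ) : partialBest B g i a b (t + 1) =
    if t / B ≤ a ∧ t % B ≤ b then
      max (partialBest B g i a b t) (best B g i (a - t / B) (b - t % B) + g i t)
    else partialBest B g i a b t := by
  unfold partialBest
  rw [Finset.range_add_one, Finset.filter_insert]
  split_ifs with h
  · rw [Finset.sup_insert, max_comm]
  · rfl

/-- The table of the dynamic program, row by row. -/
def table (B : ℕ) (g : ℕ → ℕ → ℕ) (j : ℕ) : ℕ :=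
  best B g (j / (B * B)) (j / B % B) (j % B)

theorem table_of_lt {j : ℕ} (hj : j < B * B) : table B g j = 0 := by
  rw [table, Nat.div_eq_of_lt hj, best]

theorem table_add (hB : 0 < B) (j : ℕ) : table B g (B * B + j) =
    partialBest B g (j / (B * B)) (j / B % B) (j % B) (B * B) := by
  have h1 : (B * B + j) / (B * B) = j / (B * B) + 1 := by
    rw [Nat.add_div_left _ (Nat.mul_pos hB hB)]
  have h2 : (B * B + j) / B % B = j / B % B := by
    rw [Nat.mul_add_div hB, Nat.add_mod_left]
  have h3 : (B * B + j) % B = j % B := by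
    rw [Nat.mul_add_mod]
  rw [table, h1, h2, h3, best, partialBest]

/-- The table entry from which the choice `q` leads to the entry `B * B + j`. -/
theorem table_sub {j q : ℕ} (hq : q < B * B) (ha : q / B ≤ j / B % B)
    (hb : q % B ≤ j % B) : q ≤ j ∧ table B g (j - q) =
      best B g (j / (B * B)) (j / B % B - q / B) (j % B - q % B) := by
  have hB : 0 < B := Nat.pos_of_ne_zero (by rintro rfl; simp at hq)
  set i := j / (B * B) with hi
  set a := j / B % B with ha'
  set b := j % B with hb'
  have hj : j = (i * B + a) * B + b := by
    rw [hi, ha', hb', ← Nat.div_div_eq_div_mul, Nat.div_add_mod' (j / B) B, Nat.div_add_mod']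
  have hq' : q = q / B * B + q % B := (Nat.div_add_mod' q B).symm
  have haB : a < B := Nat.mod_lt _ hB
  have hbB : b < B := Nat.mod_lt _ hB
  have hle : q / B * B ≤ a * B := Nat.mul_le_mul_right _ ha
  have hsub : j - q = (i * B + (a - q / B)) * B + (b - q % B) := by
    rw [Nat.add_mul, Nat.sub_mul]
    rw [Nat.add_mul] at hj
    omega
  have hqj : q ≤ j := by
    rw [Nat.add_mul] at hj
    omega
  refine ⟨hqj, ?_⟩
  have h1 : (j - q) / B = i * B + (a - q / B) := by
    rw [hsub, Nat.mul_comm, Nat.mul_add_div hB, Nat.div_eq_of_lt ((Nat.sub_le b (q % B)).trans_lt hbB),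
      add_zero]
  have h2 : (j - q) % B = b - q % B := by
    rw [hsub, Nat.mul_comm, Nat.mul_add_mod,
      Nat.mod_eq_of_lt ((Nat.sub_le b (q % B)).trans_lt hbB)]
  rw [table, ← Nat.div_div_eq_div_mul, h1, h2, Nat.mul_comm i B, Nat.mul_add_div hB,
    Nat.div_eq_of_lt ((Nat.sub_le a (q / B)).trans_lt haB), add_zero, Nat.mul_add_mod,
    Nat.mod_eq_of_lt ((Nat.sub_le a (q / B)).trans_lt haB)]

/-! ### Digits -/

theorem sum_mul_pow_lt {S : ℕ} {q : ℕ → ℕ} (hq : ∀ i, q i < S) (k : ℕ) :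
    ∑ i ∈ Finset.range k, q i * S ^ i < S ^ k := by
  induction k with
  | zero => simp
  | succ k ih =>
    rw [Finset.sum_range_succ, pow_succ]
    have := Nat.mul_le_mul_right (S ^ k) (Nat.succ_le_of_lt (hq k))
    rw [Nat.succ_mul] at this
    rw [Nat.mul_comm (S ^ k) S]
    omega

theorem digit_sum_mul_pow {S : ℕ} {q : ℕ → ℕ} (hq : ∀ i, q i < S) {k i : ℕ} (hi : i < k) :
    (∑ j ∈ Finset.range k, q j * S ^ j) / S ^ i % S = q i := by
  have hS : 0 < S := (Nat.zero_le _).trans_lt (hq 0)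
  induction k with
  | zero => omega
  | succ k ih =>
    rw [Finset.sum_range_succ]
    rcases Nat.lt_succ_iff_lt_or_eq.1 hi with h | rfl
    · obtain ⟨c, rfl⟩ := Nat.exists_eq_add_of_lt h
      have : q (i + c + 1) * S ^ (i + c + 1) = S ^ i * (S * (q (i + c + 1) * S ^ c)) := by ring
      rw [this, Nat.add_mul_div_left _ _ (pow_pos hS _), Nat.add_mul_mod_self_left]
      exact ih h
    · rw [Nat.add_mul_div_right _ _ (pow_pos hS _), Nat.div_eq_of_lt (sum_mul_pow_lt hq _), zero_add,
        Nat.mod_eq_of_lt (hq _)]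

end Blotto

/-! ### The dynamic program on the machine -/

/-!
Registers below 13 hold constants (see `Ready`). The others are used as follows:

* 13: the choices recorded by the last multiplier that passed;
* 15, 16: the index of the candidate numerator and the numerator `N`;
* 17, 18: `D - 1` and the denominator `D`;
* 19: the position `j` in the table, whose digits are the battlefield (20) and the remaining troops
  of the two strategies (23, 24);
* 21, 22, 25: the weight `w` of the battlefield, `w * D`, and a test for heaviness;
* 26: the running maximum;
* 27, 28, 29: a choice `q` and its two digits, the troops of the two strategies on the battlefield;
* 40: the loop test; 50 to 61: reserved for `mul` and `mulPow`; 14 and 30 to 35: intermediate results.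

Since subtraction is truncated, `x + (y - x)` is the maximum and `x - (x - y)` the minimum of `x` and `y`.
-/

namespace Blotto

open RAM

/-- Computes the price of assigning `reg 28` and `reg 29` troops into `reg 34`. If only one strategy is
wanted (`reg 7 = 0`), it replaces the second one. -/
def priceProg : Prog :=
  .seq (.ite 7 .skip (block [.const 30 0, .add 29 28 30])) <|
  .seq (mul 30 16 28) <|
  .seq (mul 31 16 29) <|
  .seq (block [.sub 32 30 31, .add 34 31 32, .sub 33 30 32]) <|
  .ite 25 .skip (block [.add 33 22 33, .sub 32 34 33, .sub 34 34 32, .add 33 22 22,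
    .sub 32 34 33, .sub 34 34 32])

theorem wp_priceProg {M N D U w a b f : ℕ} {s : State} (h7 : s.reg 7 = f) (h16 : s.reg 16 = N)
    (h22 : s.reg 22 = w * D) (h25 : s.reg 25 = 3 * w + 1 - U) (h28 : s.reg 28 = a)
    (h29 : s.reg 29 = b) (ha : a ≤ M) (hb : b ≤ M) :
    Wp M priceProg (fun s' => s'.reg 34 = price N D U w a (if f = 0 then a else b) ∧
      s'.mem = s.mem) s := by
  refine wp_seq ((Wp.frame (Q := fun s' => s'.reg 29 = (if f = 0 then a else b) ∧
    s'.mem = s.mem) ?_).mono ?_)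
  · refine wp_ite (fun h => wp_skip ?_) (fun h => wp_block ?_)
    · rw [h7] at h; simp [h, h29]
    · rw [h7] at h; simp [Instr.run, h, h28]
  rintro s1 ⟨⟨k29, kmem⟩, hk⟩
  have k16 := (hk 16 rfl).trans h16
  have k22 := (hk 22 rfl).trans h22
  have k25 := (hk 25 rfl).trans h25
  have k28 := (hk 28 rfl).trans h28
  set b' := if f = 0 then a else b with hb'
  have hb'M : b' ≤ M := by rw [hb']; split_ifs <;> assumption
  refine wp_seq (wp_mul (by decide) (by decide) (by decide) (by decide) (by decide) (by omega) ?_)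
  intro f1 hf1 hk1
  refine wp_seq (wp_mul (by decide) (by decide) (by decide) (by decide) (by decide)
    ((hk1 29 (by decide) (by decide)).trans_le (k29.trans_le hb'M)) ?_)
  intro f2 hf2 hk2
  simp only at hf2 hk2
  have e30 : f2 30 = N * a := by rw [hk2 30 (by decide) (by decide), hf1, k16, k28]
  have e31 : f2 31 = N * b' := by
    rw [hf2, hk1 16 (by decide) (by decide), hk1 29 (by decide) (by decide), k16, k29]
  have e22 : f2 22 = w * D := by
    rw [hk2 22 (by decide) (by decide), hk1 22 (by decide) (by decide), k22]
  have e25 : f2 25 = 3 * w + 1 - U := by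
    rw [hk2 25 (by decide) (by decide), hk1 25 (by decide) (by decide), k25]
  refine wp_seq (wp_block ?_)
  have hmax : N * b' + (N * a - N * b') = N * max a b' := by
    rw [← Nat.mul_max_mul_left]; omega
  have hmin : N * a - (N * a - N * b') = N * min a b' := by
    rw [← Nat.mul_min_mul_left]; omega
  refine wp_ite (fun h => wp_skip ?_) (fun h => wp_block ?_)
  · have hU : U ≤ 3 * w := by
      simp [Instr.run, e25] at h; omega
    simp [Instr.run, e30, e31, hmax, price, hU, kmem]
  · have hU : ¬ U ≤ 3 * w := by
      simp [Instr.run, e25] at h; omega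
    simp [Instr.run, e30, e31, e22, hmax, hmin, price, hU, kmem, Nat.mul_comm w D]
    omega

/-- Updates the running maximum in `reg 26` with the choice `q = reg 27`, if enough troops remain. The
table entry from which `q` leads to the current one is `q` places before the current position, by
`table_sub`. -/
def choiceProg : Prog :=
  .seq (block [.div 28 27 3, .mod 29 27 3, .sub 30 28 23, .sub 31 29 24, .add 30 30 31]) <|
  .ite 30 .skip <|
  .seq priceProg <|
  .seq (block [.const 32 0, .add 35 27 32]) <|
  .seq (mulPow 35 4 20) <|
  block [.add 34 34 35, .sub 32 19 27, .add 32 8 32, .load 32 32, .add 34 34 32, .sub 34 34 26,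
    .add 26 26 34]

/-- The value of the choice `q` for battlefield `i` in the dynamic program: the price of the two digits
of `q` in base `B`, plus a term that records the choice. The weights `w` and `U` will be multiples of
`(B * B) ^ k`, so that the recording terms do not interfere with the prices. For `f = 0` the second digit
is ignored. -/
def entry (B f N D U : ℕ) (w : ℕ → ℕ) (i q : ℕ) : ℕ :=
  price N D U (w i) (q / B) (if f = 0 then q / B else q % B) + q * (B * B) ^ i

/-- The registers that stay constant throughout the search. Here `U` is the scaled target utility, and
`f` is `1` if two strategies are wanted, and `0` if one. -/
structure Ready (n m k U f : ℕ) (s : State) : Prop where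
  r0 : s.reg 0 = n
  r1 : s.reg 1 = m
  r2 : s.reg 2 = k
  r3 : s.reg 3 = n + 1
  r4 : s.reg 4 = (n + 1) * (n + 1)
  r5 : s.reg 5 = ((n + 1) * (n + 1)) ^ k
  r6 : s.reg 6 = U
  r7 : s.reg 7 = f
  r8 : s.reg 8 = 8 + k
  r9 : s.reg 9 = k + 1
  r10 : s.reg 10 = 2 * (n + 1)
  r11 : s.reg 11 = (n + 1) * (n + 1) * k
  r12 : s.reg 12 = 7

theorem Ready.congr {n m k U f : ℕ} {s s' : State} (h : Ready n m k U f s)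
    (hr : ∀ r < 13, s'.reg r = s.reg r) : Ready n m k U f s' := by
  constructor
  · rw [hr _ (by decide), h.r0]
  · rw [hr _ (by decide), h.r1]
  · rw [hr _ (by decide), h.r2]
  · rw [hr _ (by decide), h.r3]
  · rw [hr _ (by decide), h.r4]
  · rw [hr _ (by decide), h.r5]
  · rw [hr _ (by decide), h.r6]
  · rw [hr _ (by decide), h.r7]
  · rw [hr _ (by decide), h.r8]
  · rw [hr _ (by decide), h.r9]
  · rw [hr _ (by decide), h.r10]
  · rw [hr _ (by decide), h.r11]
  · rw [hr _ (by decide), h.r12]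

/-- A bound for the number of iterations of every loop. -/
structure Bounded (M n m k : ℕ) : Prop where
  hm : m ≤ M
  hn : 2 * (n + 1) ≤ M
  hk : k + 1 ≤ M
  hS : (n + 1) * (n + 1) ≤ M
  hkS : (n + 1) * (n + 1) * k ≤ M

theorem wp_choiceProg {M n m k U f N D j c q : ℕ} {w : ℕ → ℕ} {s : State}
    (hs : Ready n m k U f s) (hM : Bounded M n m k) (hj : j < (n + 1) * (n + 1) * k)
    (h16 : s.reg 16 = N) (h19 : s.reg 19 = j) (h20 : s.reg 20 = j / ((n + 1) * (n + 1)))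
    (h22 : s.reg 22 = w (j / ((n + 1) * (n + 1))) * D) (h23 : s.reg 23 = j / (n + 1) % (n + 1))
    (h24 : s.reg 24 = j % (n + 1)) (h25 : s.reg 25 = 3 * w (j / ((n + 1) * (n + 1))) + 1 - U)
    (h26 : s.reg 26 = c) (h27 : s.reg 27 = q) (hq : q < (n + 1) * (n + 1))
    (hmem : ∀ x ≤ j, s.mem (8 + k + x) = table (n + 1) (entry (n + 1) f N D U w) x) :
    Wp M choiceProg (fun s' => s'.mem = s.mem ∧
      s'.reg 26 = if q / (n + 1) ≤ j / (n + 1) % (n + 1) ∧ q % (n + 1) ≤ j % (n + 1) then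
        max c (best (n + 1) (entry (n + 1) f N D U w) (j / ((n + 1) * (n + 1)))
          (j / (n + 1) % (n + 1) - q / (n + 1)) (j % (n + 1) - q % (n + 1)) +
            entry (n + 1) f N D U w (j / ((n + 1) * (n + 1))) q)
      else c) s := by
  have hi : j / ((n + 1) * (n + 1)) ≤ M := by
    have := Nat.div_lt_of_lt_mul hj
    have := hM.hk
    omega
  have hqM := hM.hn
  have hqd : q / (n + 1) < n + 1 := Nat.div_lt_of_lt_mul hq
  have hqm : q % (n + 1) < n + 1 := Nat.mod_lt _ (by omega)
  refine wp_seq ((Wp.frame (Q := fun s' => s'.mem = s.mem ∧ s'.reg 28 = q / (n + 1) ∧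
    s'.reg 29 = q % (n + 1) ∧ s'.reg 30 = q / (n + 1) - j / (n + 1) % (n + 1) +
      (q % (n + 1) - j % (n + 1))) ?_).mono ?_)
  · refine wp_block ?_
    simp [Instr.run, h27, hs.r3, h23, h24]
  rintro s1 ⟨⟨k0, k28, k29, k30⟩, hk⟩
  refine wp_ite (fun h => wp_skip ?_) (fun h => ?_)
  · rw [if_neg (by omega)]
    exact ⟨k0, (hk 26 rfl).trans h26⟩
  have hle : q / (n + 1) ≤ j / (n + 1) % (n + 1) ∧ q % (n + 1) ≤ j % (n + 1) := by omega
  rw [if_pos hle]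
  obtain ⟨hqj, htab⟩ := table_sub (g := entry (n + 1) f N D U w) hq hle.1 hle.2
  refine wp_seq ((wp_priceProg ((hk 7 rfl).trans hs.r7) ((hk 16 rfl).trans h16)
    ((hk 22 rfl).trans h22) ((hk 25 rfl).trans h25) k28 k29 (by omega) (by omega)).frame.mono ?_)
  rintro s2 ⟨⟨l34, l0⟩, hl⟩
  have l4 := (hl 4 rfl).trans ((hk 4 rfl).trans hs.r4)
  have l8 := (hl 8 rfl).trans ((hk 8 rfl).trans hs.r8)
  have l19 := (hl 19 rfl).trans ((hk 19 rfl).trans h19)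
  have l20 := (hl 20 rfl).trans ((hk 20 rfl).trans h20)
  have l26 := (hl 26 rfl).trans ((hk 26 rfl).trans h26)
  have l27 := (hl 27 rfl).trans ((hk 27 rfl).trans h27)
  refine wp_seq (wp_block (wp_seq (wp_mulPow (by decide) (by decide) (by decide) (by decide)
    (by decide) ?_ ?_ ?_)))
  · simpa [Instr.run, l4] using hM.hS
  · simpa [Instr.run, l20] using hi
  intro f1 hf1 hk1
  refine wp_block ?_
  have m8 := hk1 8 (by decide) (by decide)
  have m19 := hk1 19 (by decide) (by decide)
  have m26 := hk1 26 (by decide) (by decide)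
  have m27 := hk1 27 (by decide) (by decide)
  have m34 := hk1 34 (by decide) (by decide)
  simp [Instr.run, l8, l19, l26, l27, l34, l4, l20] at hf1 m8 m19 m26 m27 m34
  simp [Instr.run, hf1, m8, m19, m26, m27, m34, l0, k0, hmem _ (Nat.sub_le j q), htab]
  unfold entry
  omega

/-- Computes the table entry one layer, that is `reg 4` places, after the position `reg 19`, and
stores it. -/
def entryProg : Prog :=
  .seq (block [.div 20 19 4, .add 21 12 20, .load 21 21, .div 23 19 3, .mod 23 23 3, .mod 24 19 3,
    .add 25 21 21, .add 25 25 21, .const 26 1, .add 25 25 26, .sub 25 25 6, .const 26 0]) <|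
  .seq (mul 22 21 18) <|
  .seq (forLoop 27 40 4 choiceProg) <|
  block [.add 30 8 4, .add 30 30 19, .store 30 26]

theorem wp_entryProg {M n m k U f N D j : ℕ} {w : ℕ → ℕ} {s : State}
    (hs : Ready n m k U f s) (hM : Bounded M n m k) (hj : j < (n + 1) * (n + 1) * k)
    (h16 : s.reg 16 = N) (h18 : s.reg 18 = D) (hD : D ≤ M) (h19 : s.reg 19 = j)
    (hw : ∀ i ≤ k, s.mem (7 + i) = w i)
    (hmem : ∀ x ≤ j, s.mem (8 + k + x) = table (n + 1) (entry (n + 1) f N D U w) x) :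
    Wp M entryProg (fun s' => s'.mem = Function.update s.mem (8 + k + ((n + 1) * (n + 1) + j))
      (table (n + 1) (entry (n + 1) f N D U w) ((n + 1) * (n + 1) + j))) s := by
  have hi : j / ((n + 1) * (n + 1)) < k := Nat.div_lt_of_lt_mul hj
  refine wp_seq ((Wp.frame (Q := fun s' => s'.mem = s.mem ∧
    s'.reg 20 = j / ((n + 1) * (n + 1)) ∧ s'.reg 21 = w (j / ((n + 1) * (n + 1))) ∧
    s'.reg 23 = j / (n + 1) % (n + 1) ∧ s'.reg 24 = j % (n + 1) ∧
    s'.reg 25 = 3 * w (j / ((n + 1) * (n + 1))) + 1 - U ∧ s'.reg 26 = 0) ?_).mono ?_)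
  · refine wp_block ?_
    simp [Instr.run, h19, hs.r3, hs.r4, hs.r6, hs.r12, hw _ hi.le]
    omega
  rintro s1 ⟨⟨k0, k20, k21, k23, k24, k25, k26⟩, hk⟩
  refine wp_seq (wp_mul (by decide) (by decide) (by decide) (by decide) (by decide)
    (by rw [hk 18 rfl, h18]; exact hD) ?_)
  intro f1 hf1 hk1
  rw [k21, hk 18 rfl, h18] at hf1
  have hs1 : Ready n m k U f ⟨f1, s1.mem⟩ := hs.congr fun r hr => by
    show f1 r = _
    rw [hk1 r (by omega) (by omega)]
    interval_cases r <;> exact hk _ rfl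
  refine wp_seq (wp_forLoop (fun t s' => s'.mem = s.mem ∧
    s'.reg 26 = partialBest (n + 1) (entry (n + 1) f N D U w) (j / ((n + 1) * (n + 1)))
      (j / (n + 1) % (n + 1)) (j % (n + 1)) t) rfl rfl (by decide) ?_ ?_ ?_ ?_)
  · exact hs1.r4.trans_le hM.hS
  · simp [k0, hk1 26, k26, partialBest]
  · rintro q hq s2 hq2 hl ⟨l0, l26⟩
    have hs2 : Ready n m k U f s2 := hs1.congr fun r hr => by interval_cases r <;> exact hl _ rfl
    have e : ∀ r < 60, r ≠ 22 → (forLoop 27 40 4 choiceProg).keeps r = true →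
      s2.reg r = s1.reg r := fun r h1 h2 h3 => (hl r h3).trans (hk1 r h1 h2)
    refine (wp_choiceProg hs2 hM hj (N := N) (D := D) (w := w)
      ((e 16 (by decide) (by decide) rfl).trans ((hk 16 rfl).trans h16))
      ((e 19 (by decide) (by decide) rfl).trans ((hk 19 rfl).trans h19))
      ((e 20 (by decide) (by decide) rfl).trans k20)
      ((hl 22 rfl).trans hf1)
      ((e 23 (by decide) (by decide) rfl).trans k23)
      ((e 24 (by decide) (by decide) rfl).trans k24)
      ((e 25 (by decide) (by decide) rfl).trans k25) l26 hq2 (hs1.r4 ▸ hq)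
      (fun x hx => l0 ▸ hmem x hx)).mono ?_
    rintro s3 ⟨n0, n26⟩
    refine ⟨n0.trans l0, ?_⟩
    simpa [partialBest_succ] using n26
  · rintro s2 hl ⟨l0, l26⟩
    refine wp_block ?_
    have l4 := (hl 4 rfl).trans hs1.r4
    have l8 := (hl 8 rfl).trans hs1.r8
    have l19 : s2.reg 19 = j := (hl 19 rfl).trans ((hk1 19 (by decide) (by decide)).trans
      ((hk 19 rfl).trans h19))
    rw [show (⟨f1, s1.mem⟩ : State).reg 4 = _ from hs1.r4, ← table_add (Nat.succ_pos n)] at l26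
    simp [Instr.run, l0, l4, l8, l19, l26, add_assoc]

end Blotto

/-! ### The search, the input and the output on the machine -/

namespace Blotto

open RAM

/-- The last entry of the table is the optimum for the full budgets. -/
theorem table_last (n k : ℕ) (g : ℕ → ℕ → ℕ) :
    table (n + 1) g ((n + 1) * (n + 1) * k + (n + 1) * (n + 1) - 1) = best (n + 1) g k n n := by
  have h : (n + 1) * (n + 1) * k + (n + 1) * (n + 1) - 1 = (n + 1) * ((n + 1) * k + n) + n := by
    have : (n + 1) * (n + 1) * k + (n + 1) * (n + 1) = (n + 1) * ((n + 1) * k + n) + n + 1 := by ring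
    omega
  rw [table, ← Nat.div_div_eq_div_mul, h, Nat.mul_add_div n.succ_pos,
    Nat.div_eq_of_lt n.lt_succ_self, add_zero, Nat.mul_add_div n.succ_pos,
    Nat.div_eq_of_lt n.lt_succ_self, add_zero, Nat.mul_add_mod, Nat.mod_eq_of_lt n.lt_succ_self,
    Nat.mul_add_mod, Nat.mod_eq_of_lt n.lt_succ_self]

/-- The input part of the memory during the search: the scaled weights `w`, and the first layer of
the table. -/
structure Loaded (n k : ℕ) (w : ℕ → ℕ) (s : State) : Prop where
  weight : ∀ i ≤ k, s.mem (7 + i) = w i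
  zero : ∀ x < (n + 1) * (n + 1), s.mem (8 + k + x) = 0

theorem Loaded.congr {n k : ℕ} {w : ℕ → ℕ} {s s' : State} (h : Loaded n k w s)
    (hm : ∀ x < 8 + k + (n + 1) * (n + 1), s'.mem x = s.mem x) : Loaded n k w s' :=
  ⟨fun i hi => by rw [hm _ (by omega), h.weight i hi],
    fun x hx => by rw [hm _ (by omega), h.zero x hx]⟩

theorem wp_fill {M n m k U f N D : ℕ} {w : ℕ → ℕ} {s : State}
    (hs : Ready n m k U f s) (hM : Bounded M n m k) (hw : Loaded n k w s)
    (h16 : s.reg 16 = N) (h18 : s.reg 18 = D) (hD : D ≤ M) :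
    Wp M (forLoop 19 40 11 entryProg) (fun s' => Loaded n k w s' ∧
      ∀ x < (n + 1) * (n + 1) + (n + 1) * (n + 1) * k,
        s'.mem (8 + k + x) = table (n + 1) (entry (n + 1) f N D U w) x) s := by
  refine wp_forLoop (fun j s' => Loaded n k w s' ∧ ∀ x < (n + 1) * (n + 1) + j,
    s'.mem (8 + k + x) = table (n + 1) (entry (n + 1) f N D U w) x) rfl rfl (by decide) ?_ ?_ ?_ ?_
  · exact hs.r11.trans_le hM.hkS
  · refine ⟨hw.congr fun x _ => rfl, fun x hx => ?_⟩
    rw [table_of_lt hx]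
    exact hw.zero x hx
  · rintro j hj s' h19 hk ⟨hw', ht⟩
    rw [hs.r11] at hj
    have hs' : Ready n m k U f s' := hs.congr fun r hr => by interval_cases r <;> exact hk _ rfl
    have hpos : 0 < (n + 1) * (n + 1) := by positivity
    refine (wp_entryProg hs' hM hj ((hk 16 rfl).trans h16) ((hk 18 rfl).trans h18) hD h19
      hw'.weight fun x hx => ht x (by omega)).mono ?_
    intro s'' hm
    refine ⟨hw'.congr fun x hx => ?_, fun x hx => ?_⟩
    · simp only [hm]
      rw [Function.update_of_ne (by omega)]
    · simp only [hm]
      by_cases hxj : x = (n + 1) * (n + 1) + j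
      · rw [hxj, Function.update_self]
      · rw [Function.update_of_ne (by omega), ht x (by omega)]
  · rintro s' - ⟨hw', ht⟩
    rw [hs.r11] at ht
    exact ⟨hw', ht⟩

/-- Solves the dynamic program for the multiplier `reg 16 / (reg 17 + 1)`, and records the optimal
choices in `reg 13` if the bound is large enough. -/
def testProg : Prog :=
  .seq (block [.const 18 1, .add 18 17 18]) <|
  .seq (forLoop 19 40 11 entryProg) <|
  .seq (block [.add 30 8 11, .add 30 30 4, .const 31 1, .sub 30 30 31, .load 30 30,
    .mod 31 30 5, .sub 30 30 31, .add 32 30 30, .add 30 30 32]) <|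
  .seq (mul 33 6 18) <|
  .seq (mul 34 16 1) <|
  .seq (block [.add 33 33 33, .add 33 33 34, .add 33 33 34, .add 33 33 34, .sub 33 33 30]) <|
  .ite 33 .skip (block [.const 30 0, .add 13 31 30])

/-- The optimum of the dynamic program. -/
def optimum (n k U f : ℕ) (w : ℕ → ℕ) (N D : ℕ) : ℕ :=
  best (n + 1) (entry (n + 1) f N D U w) k n n

/-- The part of the optimum that records the optimal choices. -/
def code (n k U f : ℕ) (w : ℕ → ℕ) (N D : ℕ) : ℕ :=
  optimum n k U f w N D % ((n + 1) * (n + 1)) ^ k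

/-- The Lagrangian bound for the multiplier `N / D` is at least `2 * U / 3`. -/
def Passes (n m k U f : ℕ) (w : ℕ → ℕ) (N D : ℕ) : Prop :=
  2 * (U * D) + 3 * (N * m) ≤ 3 * (optimum n k U f w N D - code n k U f w N D)

open Classical in
theorem wp_testProg {M n m k U f N d c : ℕ} {w : ℕ → ℕ} {s : State}
    (hs : Ready n m k U f s) (hM : Bounded M n m k) (hw : Loaded n k w s)
    (h16 : s.reg 16 = N) (h17 : s.reg 17 = d) (hd : d < 2 * (n + 1)) (h13 : s.reg 13 = c) :
    Wp M testProg (fun s' => Loaded n k w s' ∧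
      s'.reg 13 = if Passes n m k U f w N (d + 1) then code n k U f w N (d + 1) else c) s := by
  refine wp_seq (wp_block ?_)
  set s1 := List.foldl (fun s (c : Instr) => c.run s) s [.const 18 1, .add 18 17 18] with hs1
  have k18 : s1.reg 18 = d + 1 := by simp [hs1, Instr.run, h17]
  have hkr : ∀ r, r ≠ 18 → s1.reg r = s.reg r := fun r hr => by simp [hs1, Instr.run, hr]
  have hD : d + 1 ≤ M := by have := hM.hn; omega
  refine wp_seq ((wp_fill (hs.congr fun r hr => hkr r (by omega)) hM (hw.congr fun x hx => rfl)
    ((hkr 16 (by decide)).trans h16) k18 hD).frame.mono ?_)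
  rintro s2 ⟨⟨hw2, ht⟩, hl⟩
  have e : ∀ r, r ≠ 18 → (forLoop 19 40 11 entryProg).keeps r = true → s2.reg r = s.reg r :=
    fun r h1 h2 => (hl r h2).trans (hkr r h1)
  have l1 := (e 1 (by decide) rfl).trans hs.r1
  have l4 := (e 4 (by decide) rfl).trans hs.r4
  have l5 := (e 5 (by decide) rfl).trans hs.r5
  have l6 := (e 6 (by decide) rfl).trans hs.r6
  have l8 := (e 8 (by decide) rfl).trans hs.r8
  have l11 := (e 11 (by decide) rfl).trans hs.r11
  have l13 := (e 13 (by decide) rfl).trans h13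
  have l16 := (e 16 (by decide) rfl).trans h16
  have l18 := (hl 18 rfl).trans k18
  have hpos : 0 < (n + 1) * (n + 1) := by positivity
  have hopt : s2.mem (8 + k + (n + 1) * (n + 1) * k + (n + 1) * (n + 1) - 1) =
      optimum n k U f w N (d + 1) := by
    rw [optimum, ← table_last, ← ht _ (by omega)]
    congr 1
    omega
  refine wp_seq (wp_block (wp_seq (wp_mul (by decide) (by decide) (by decide) (by decide)
    (by decide) ?_ ?_)))
  · simpa [Instr.run, l18] using hD
  intro f1 hf1 hk1
  refine wp_seq (wp_mul (by decide) (by decide) (by decide) (by decide) (by decide) ?_ ?_)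
  · show f1 1 ≤ M
    rw [hk1 1 (by decide) (by decide)]
    simpa [Instr.run, l1] using hM.hm
  intro f2 hf2 hk2
  have m33 : f2 33 = U * (d + 1) := by
    rw [hk2 33 (by decide) (by decide)]
    show f1 33 = _
    rw [hf1]
    simp [Instr.run, l6, l18]
  have m34 : f2 34 = N * m := by
    rw [hf2]
    show f1 16 * f1 1 = _
    rw [hk1 16 (by decide) (by decide), hk1 1 (by decide) (by decide)]
    simp [Instr.run, l16, l1]
  have m13 : f2 13 = c := by
    rw [hk2 13 (by decide) (by decide)]
    show f1 13 = _
    rw [hk1 13 (by decide) (by decide)]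
    simp [Instr.run, l13]
  have m31 : f2 31 = code n k U f w N (d + 1) := by
    rw [hk2 31 (by decide) (by decide)]
    show f1 31 = _
    rw [hk1 31 (by decide) (by decide)]
    simp [Instr.run, l8, l4, l11, hopt, l5, code]
  have m30 : f2 30 = 3 * (optimum n k U f w N (d + 1) - code n k U f w N (d + 1)) := by
    rw [hk2 30 (by decide) (by decide)]
    show f1 30 = _
    rw [hk1 30 (by decide) (by decide)]
    simp [Instr.run, l8, l4, l11, hopt, l5, code]
    omega
  refine wp_seq (wp_block (wp_ite (fun h => wp_skip ?_) (fun h => wp_block ?_)))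
  · refine ⟨hw2.congr fun x hx => by simp [Instr.run], ?_⟩
    have hp : ¬ Passes n m k U f w N (d + 1) := by
      simp [Instr.run, m30, m33, m34] at h
      unfold Passes
      omega
    simp [Instr.run, m13, hp]
  · refine ⟨hw2.congr fun x hx => by simp [Instr.run], ?_⟩
    have hp : Passes n m k U f w N (d + 1) := by
      simp [Instr.run, m30, m33, m34] at h
      unfold Passes
      omega
    simp [Instr.run, m31, hp]

/-- Tries all multipliers `2 * w l / (d + 1)`, where the target utility counts as the last weight. -/
def searchProg : Prog :=
  forLoop 15 40 9 (.seq (block [.add 16 12 15, .load 16 16, .add 16 16 16])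
    (forLoop 17 40 10 testProg))

theorem wp_searchProg {M n m k U f : ℕ} {w : ℕ → ℕ} {s : State}
    (hs : Ready n m k U f s) (hM : Bounded M n m k) (hw : Loaded n k w s) :
    Wp M searchProg (fun s' =>
      (∃ l ≤ k, ∃ d < 2 * (n + 1), Passes n m k U f w (w l + w l) (d + 1)) →
        ∃ l ≤ k, ∃ d < 2 * (n + 1), Passes n m k U f w (w l + w l) (d + 1) ∧
          s'.reg 13 = code n k U f w (w l + w l) (d + 1)) s := by
  classical
  -- some multiplier that passes is recorded
  set R : ℕ → Prop := fun c => ∃ l ≤ k, ∃ d < 2 * (n + 1),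
    Passes n m k U f w (w l + w l) (d + 1) ∧ c = code n k U f w (w l + w l) (d + 1) with hR
  refine wp_forLoop (fun j s' => Loaded n k w s' ∧
    ((∃ l < j, ∃ d < 2 * (n + 1), Passes n m k U f w (w l + w l) (d + 1)) → R (s'.reg 13)))
    rfl rfl (by decide) ?_ ?_ ?_ ?_
  · exact hs.r9.trans_le hM.hk
  · exact ⟨hw.congr fun x hx => rfl, by simp⟩
  · rintro l hl s1 h15 hk ⟨hw1, hR1⟩
    rw [hs.r9] at hl
    have hs1 : Ready n m k U f s1 := hs.congr fun r hr => by interval_cases r <;> exact hk _ rfl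
    refine wp_seq (wp_block ?_)
    set s2 := List.foldl (fun s (c : Instr) => c.run s) s1
      [.add 16 12 15, .load 16 16, .add 16 16 16] with hs2
    have k16 : s2.reg 16 = w l + w l := by
      simp [hs2, Instr.run, h15, hs1.r12, hw1.weight l (by omega)]
    have hkr : ∀ r, r ≠ 16 → s2.reg r = s1.reg r := fun r hr => by simp [hs2, Instr.run, hr]
    have hs2r : Ready n m k U f s2 := hs1.congr fun r hr => hkr r (by omega)
    refine wp_forLoop (fun j s' => Loaded n k w s' ∧
      ((∃ l' < l, ∃ d < 2 * (n + 1), Passes n m k U f w (w l' + w l') (d + 1)) ∨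
        (∃ d < j, Passes n m k U f w (w l + w l) (d + 1)) → R (s'.reg 13)))
      rfl rfl (by decide) ?_ ?_ ?_ ?_
    · exact hs2r.r10.trans_le hM.hn
    · refine ⟨hw1.congr fun x hx => rfl, ?_⟩
      simpa [hkr] using hR1
    · rintro d hd s3 h17 hk3 ⟨hw3, hR3⟩
      rw [hs2r.r10] at hd
      have hs3 : Ready n m k U f s3 :=
        hs2r.congr fun r hr => by interval_cases r <;> exact hk3 _ rfl
      refine (wp_testProg hs3 hM hw3 ((hk3 16 rfl).trans k16) h17 hd rfl).mono ?_
      rintro s4 ⟨hw4, h4⟩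
      refine ⟨hw4.congr fun x hx => rfl, fun h => ?_⟩
      have h5 : R (s4.reg 13) := by
        rw [h4]
        split_ifs with hp
        · exact ⟨l, by omega, d, hd, hp, rfl⟩
        · refine hR3 (h.imp_right ?_)
          rintro ⟨d', hd', hp'⟩
          refine ⟨d', lt_of_le_of_ne (Nat.le_of_lt_succ hd') ?_, hp'⟩
          rintro rfl
          exact hp hp'
      simpa using h5
    · rintro s3 - ⟨hw3, hR3⟩
      rw [hs2r.r10] at hR3
      refine ⟨hw3.congr fun x hx => rfl, ?_⟩
      rintro ⟨l', hl', d, hd, hp⟩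
      have h5 : R (s3.reg 13) := by
        rcases Nat.lt_succ_iff_lt_or_eq.1 hl' with h | rfl
        · exact hR3 (.inl ⟨l', h, d, hd, hp⟩)
        · exact hR3 (.inr ⟨d, hd, hp⟩)
      simpa using h5
  · rintro s' - ⟨-, hR'⟩ ⟨l, hl, d, hd, hp⟩
    rw [hs.r9] at hR'
    exact hR' ⟨l, by omega, d, hd, hp⟩

/-- Reads the input, prepares the constants, and scales the weights and the target utility. The latter
is rounded up, and replaced by `0` if `p = 0`, when nothing is required of the output. It is stored after
the weights, since it is a candidate numerator like them. -/
def setupProg : Prog :=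
  .seq (block [.const 14 0, .load 0 14, .const 14 1, .load 1 14, .const 14 2, .load 2 14,
    .const 14 3, .load 6 14, .const 14 4, .load 15 14, .const 14 5, .load 16 14, .const 14 6,
    .load 17 14, .const 18 1, .add 6 6 15, .sub 6 6 18, .div 6 6 15, .add 3 0 18, .add 10 3 3,
    .add 9 2 18, .const 12 7]) <|
  .seq (.ite 16 .skip (block [.const 6 0])) <|
  .seq (block [.add 8 12 2, .store 8 6, .add 8 8 18, .add 16 16 16, .sub 16 16 17, .const 7 1]) <|
  .seq (.ite 16 (block [.const 7 0]) .skip) <|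
  .seq (mul 4 3 3) <|
  .seq (mul 11 4 2) <|
  .seq (block [.const 5 1]) <|
  .seq (mulPow 5 4 2) <|
  .seq (forLoop 15 40 9 (.seq (block [.add 16 12 15, .load 17 16]) <|
    .seq (mulPow 17 4 2) <| block [.store 16 17])) <|
  block [.add 14 12 2, .load 6 14]

/-- The input as it stands in the memory, with `u = a / b` and `p = c / e`. -/
structure Input (n m k a b c e : ℕ) (w : ℕ → ℕ) (s : State) : Prop where
  m0 : s.mem 0 = n
  m1 : s.mem 1 = m
  m2 : s.mem 2 = k
  m3 : s.mem 3 = a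
  m4 : s.mem 4 = b
  m5 : s.mem 5 = c
  m6 : s.mem 6 = e
  mw : ∀ i < k, s.mem (7 + i) = w i
  mz : ∀ x, s.mem (8 + k + x) = 0

/-- The requirement on `w k` says that it is the target utility as `setupProg` computes it. -/
theorem wp_setupProg {M n m k a b c e : ℕ} {w : ℕ → ℕ} {s : State}
    (hM : Bounded M n m k) (hs : Input n m k a b c e w s)
    (hwk : w k = if c = 0 then 0 else (a + b - 1) / b) :
    Wp M setupProg (fun s' =>
      Ready n m k (w k * ((n + 1) * (n + 1)) ^ k) (if c + c - e = 0 then 1 else 0) s' ∧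
      Loaded n k (fun i => w i * ((n + 1) * (n + 1)) ^ k) s') s := by
  set f := if c + c - e = 0 then 1 else 0 with hf
  set S := (n + 1) * (n + 1) with hS
  refine wp_seq ((wp_block (Q := fun s' => s'.mem = s.mem ∧ s'.reg 0 = n ∧ s'.reg 1 = m ∧
    s'.reg 2 = k ∧ s'.reg 3 = n + 1 ∧ s'.reg 6 = (a + b - 1) / b ∧ s'.reg 9 = k + 1 ∧
    s'.reg 10 = 2 * (n + 1) ∧ s'.reg 12 = 7 ∧ s'.reg 16 = c ∧ s'.reg 17 = e ∧ s'.reg 18 = 1)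
    ?_).mono ?_)
  · simp [Instr.run, hs.m0, hs.m1, hs.m2, hs.m3, hs.m4, hs.m5, hs.m6]
    omega
  rintro s1 ⟨k0, kr0, kr1, kr2, kr3, kr6, kr9, kr10, kr12, kr16, kr17, kr18⟩
  refine wp_seq ((Wp.frame (Q := fun s' => s'.mem = s.mem ∧ s'.reg 6 = w k) ?_).mono ?_)
  · refine wp_ite (fun h => wp_skip ?_) (fun h => wp_block ?_)
    · rw [kr16] at h
      rw [if_neg h] at hwk
      exact ⟨k0, kr6.trans hwk.symm⟩
    · rw [kr16] at h
      rw [if_pos h] at hwk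
      simp [Instr.run, k0, hwk]
  rintro s2 ⟨⟨l0, l6⟩, hl⟩
  have l0' := (hl 0 rfl).trans kr0
  have l1 := (hl 1 rfl).trans kr1
  have l2 := (hl 2 rfl).trans kr2
  have l3 := (hl 3 rfl).trans kr3
  have l9 := (hl 9 rfl).trans kr9
  have l10 := (hl 10 rfl).trans kr10
  have l12 := (hl 12 rfl).trans kr12
  have l16 := (hl 16 rfl).trans kr16
  have l17 := (hl 17 rfl).trans kr17
  have l18 := (hl 18 rfl).trans kr18
  refine wp_seq ((Wp.frame (wp_block (Q := fun s' => s'.mem = Function.update s.mem (7 + k) (w k) ∧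
    s'.reg 7 = 1 ∧ s'.reg 8 = 8 + k ∧ s'.reg 16 = c + c - e) ?_)).mono ?_)
  · simp [Instr.run, l0, l12, l2, l6, l16, l17, l18]
    omega
  rintro s3 ⟨⟨n0, n7, n8, n16⟩, hn⟩
  refine wp_seq ((Wp.frame (Q := fun s' => s'.mem = s3.mem ∧ s'.reg 7 = f) ?_).mono ?_)
  · refine wp_ite (fun h => wp_block ?_) (fun h => wp_skip ?_)
    · rw [n16] at h
      simp [Instr.run, hf, h]
    · rw [n16] at h
      exact ⟨rfl, by simp [n7, hf, h]⟩
  rintro s4 ⟨⟨o0, o7⟩, ho⟩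
  have o3 := (ho 3 rfl).trans ((hn 3 rfl).trans l3)
  have o2 := (ho 2 rfl).trans ((hn 2 rfl).trans l2)
  have hnM := hM.hn
  have hkM := hM.hk
  refine wp_seq (wp_mul (by decide) (by decide) (by decide) (by decide) (by decide)
    (by omega) ?_)
  intro f1 hf1 hk1
  refine wp_seq (wp_mul (by decide) (by decide) (by decide) (by decide) (by decide)
    ((hk1 2 (by decide) (by decide)).trans_le (by omega)) ?_)
  intro f2 hf2 hk2
  simp only at hf2 hk2
  have p4 : f2 4 = S := by rw [hk2 4 (by decide) (by decide), hf1, o3]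
  have p2 : f2 2 = k := by rw [hk2 2 (by decide) (by decide), hk1 2 (by decide) (by decide), o2]
  refine wp_seq (wp_block ?_)
  refine wp_seq (wp_mulPow (by decide) (by decide) (by decide) (by decide) (by decide) ?_ ?_ ?_)
  · simpa [Instr.run, p4] using hM.hS
  · simp [Instr.run, p2]; omega
  intro f3 hf3 hk3
  have q5 : f3 5 = S ^ k := by simpa [Instr.run, p4, p2] using hf3
  have hk' : ∀ r < 50, r ≠ 4 → r ≠ 5 → r ≠ 11 → f3 r = s4.reg r := by
    intro r h1 h2 h3 h4
    rw [hk3 r h1 h3]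
    simp only [List.foldl, Instr.run, Function.update_of_ne h3]
    rw [hk2 r (by omega) h4, hk1 r (by omega) h2]
  have q4 : f3 4 = S := by
    rw [hk3 4 (by decide) (by decide)]
    simp [Instr.run, p4]
  have q11 : f3 11 = S * k := by
    rw [hk3 11 (by decide) (by decide)]
    have : (List.foldl (fun s (c : Instr) => c.run s) (⟨f2, s4.mem⟩ : State)
        [.const 5 1]).reg 11 = f2 11 := by simp [Instr.run]
    rw [this, hf2, hf1, o3, hk1 2 (by decide) (by decide), o2]
  have q2 : f3 2 = k := (hk' 2 (by decide) (by decide) (by decide) (by decide)).trans o2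
  have q9 : f3 9 = k + 1 := by
    rw [hk' 9 (by decide) (by decide) (by decide) (by decide), ho 9 rfl, hn 9 rfl, l9]
  have q12 : f3 12 = 7 := by
    rw [hk' 12 (by decide) (by decide) (by decide) (by decide), ho 12 rfl, hn 12 rfl, l12]
  have hmem : ∀ x, (List.foldl (fun s (c : Instr) => c.run s) (⟨f2, s4.mem⟩ : State)
      [.const 5 1]).mem x = Function.update s.mem (7 + k) (w k) x := by
    intro x
    simp [Instr.run, o0, n0]
  refine wp_seq (wp_forLoop (fun j s' => (∀ i ≤ k, s'.mem (7 + i) = if i < j then w i * S ^ k else w i) ∧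
    ∀ x, s'.mem (8 + k + x) = 0) rfl rfl (by decide) ?_ ?_ ?_ ?_)
  · exact q9.trans_le hM.hk
  · refine ⟨fun i hi => ?_, fun x => ?_⟩
    · simp only [hmem, not_lt_zero, if_false]
      by_cases hik : i = k
      · rw [hik, Function.update_self]
      · rw [Function.update_of_ne (by omega), hs.mw i (by omega)]
    · simp only [hmem]
      rw [Function.update_of_ne (by omega), hs.mz]
  · rintro i hi s5 h15 hk5 ⟨hw5, hz5⟩
    have hi : i < k + 1 := hi.trans_eq q9
    have r2 := (hk5 2 rfl).trans q2
    have r4 := (hk5 4 rfl).trans q4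
    have r12 := (hk5 12 rfl).trans q12
    have r17 : s5.mem (7 + i) = w i := by rw [hw5 i (by omega), if_neg (lt_irrefl _)]
    refine wp_seq (wp_block (wp_seq (wp_mulPow (by decide) (by decide) (by decide) (by decide)
      (by decide) ?_ ?_ ?_)))
    · simpa [Instr.run, r4] using hM.hS
    · simp [Instr.run, r2]; omega
    intro f4 hf4 hk4
    have t16 := hk4 16 (by decide) (by decide)
    simp [Instr.run, r4, r2, r12, h15, r17] at hf4 t16
    refine wp_block ⟨fun i' hi' => ?_, fun x => ?_⟩
    · simp only [List.foldl, Instr.run, t16, hf4]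
      by_cases hii : i' = i
      · subst hii
        simp
      · rw [Function.update_of_ne (by omega), hw5 i' hi']
        have : i' < i + 1 ↔ i' < i := by omega
        simp [this]
    · simp only [List.foldl, Instr.run, t16, hf4]
      rw [Function.update_of_ne (by omega), hz5]
  · rintro s5 hk5 ⟨hw5, hz5⟩
    simp only [q9] at hw5
    have hw5' : ∀ i ≤ k, s5.mem (7 + i) = w i * S ^ k := fun i hi => by
      rw [hw5 i hi, if_pos (by omega)]
    have e : ∀ r < 13, r ≠ 4 → r ≠ 5 → r ≠ 6 → r ≠ 11 → s5.reg r = s4.reg r := by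
      intro r h1 h2 h3 h4 h5
      rw [← hk' r (by omega) h2 h3 h5]
      interval_cases r <;> exact hk5 _ rfl
    have u12 : s5.reg 12 = 7 := (hk5 12 rfl).trans q12
    have u2 : s5.reg 2 = k := (hk5 2 rfl).trans q2
    refine wp_block ⟨?_, ⟨fun i hi => hw5' i hi, fun x _ => hz5 x⟩⟩
    have e' : ∀ r, r ≠ 14 → r ≠ 6 → (List.foldl (fun s (c : Instr) => c.run s) s5
        [.add 14 12 2, .load 6 14]).reg r = s5.reg r := by
      intro r h1 h2
      simp [Instr.run, h1, h2]
    constructor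
    · rw [e' 0 (by decide) (by decide), hk5 0 rfl]
      show f3 0 = n
      rw [hk' 0 (by decide) (by decide) (by decide) (by decide), ho 0 rfl, hn 0 rfl, l0']
    · rw [e' 1 (by decide) (by decide), hk5 1 rfl]
      show f3 1 = m
      rw [hk' 1 (by decide) (by decide) (by decide) (by decide), ho 1 rfl, hn 1 rfl, l1]
    · rw [e' 2 (by decide) (by decide), u2]
    · rw [e' 3 (by decide) (by decide), hk5 3 rfl]
      show f3 3 = n + 1
      rw [hk' 3 (by decide) (by decide) (by decide) (by decide), ho 3 rfl, hn 3 rfl, l3]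
    · rw [e' 4 (by decide) (by decide), hk5 4 rfl]
      exact q4
    · rw [e' 5 (by decide) (by decide), hk5 5 rfl]
      exact q5
    · simp [Instr.run, u12, u2, hw5' k le_rfl]
    · rw [e' 7 (by decide) (by decide), hk5 7 rfl]
      show f3 7 = f
      rw [hk' 7 (by decide) (by decide) (by decide) (by decide), o7]
    · rw [e' 8 (by decide) (by decide), hk5 8 rfl]
      show f3 8 = 8 + k
      rw [hk' 8 (by decide) (by decide) (by decide) (by decide), ho 8 rfl, n8]
    · rw [e' 9 (by decide) (by decide), hk5 9 rfl]
      exact q9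
    · rw [e' 10 (by decide) (by decide), hk5 10 rfl]
      show f3 10 = 2 * (n + 1)
      rw [hk' 10 (by decide) (by decide) (by decide) (by decide), ho 10 rfl, hn 10 rfl, l10]
    · rw [e' 11 (by decide) (by decide), hk5 11 rfl]
      exact q11
    · rw [e' 12 (by decide) (by decide), u12]

/-- Writes the strategies recorded in `reg 13` and their probabilities, which are in the ratio
`1 : reg 7`. -/
def outputProg : Prog :=
  .seq (forLoop 15 40 2 (.seq (block [.const 16 1]) <| .seq (mulPow 16 4 15) <|
    block [.div 16 13 16, .mod 16 16 4, .div 17 16 3, .mod 18 16 3, .const 19 2, .add 19 19 15,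
      .store 19 17, .add 19 19 2, .store 19 18])) <|
  block [.const 16 0, .const 17 1, .store 16 17, .store 17 7]

theorem wp_outputProg {M n m k U f c : ℕ} {s : State}
    (hs : Ready n m k U f s) (hM : Bounded M n m k) (h13 : s.reg 13 = c) :
    Wp M outputProg (fun s' => s'.mem 0 = 1 ∧ s'.mem 1 = f ∧
      (∀ i < k, s'.mem (2 + i) = c / ((n + 1) * (n + 1)) ^ i % ((n + 1) * (n + 1)) / (n + 1)) ∧
      ∀ i < k, s'.mem (2 + k + i) =
        c / ((n + 1) * (n + 1)) ^ i % ((n + 1) * (n + 1)) % (n + 1)) s := by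
  set S := (n + 1) * (n + 1) with hS
  refine wp_seq (wp_forLoop (fun j s' => (∀ i < j, s'.mem (2 + i) = c / S ^ i % S / (n + 1)) ∧
    ∀ i < j, s'.mem (2 + k + i) = c / S ^ i % S % (n + 1)) rfl rfl (by decide) ?_ ?_ ?_ ?_)
  · rw [hs.r2]
    have := hM.hk
    omega
  · simp
  · rintro i hi s1 h15 hk ⟨hx, hx'⟩
    rw [hs.r2] at hi
    have k2 := (hk 2 rfl).trans hs.r2
    have k3 := (hk 3 rfl).trans hs.r3
    have k4 := (hk 4 rfl).trans hs.r4
    have k13 := (hk 13 rfl).trans h13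
    refine wp_seq (wp_block (wp_seq (wp_mulPow (by decide) (by decide) (by decide) (by decide)
      (by decide) ?_ ?_ ?_)))
    · simpa [Instr.run, k4] using hM.hS
    · have := hM.hk
      simp [Instr.run, h15]
      omega
    intro f1 hf1 hk1
    have e2 := hk1 2 (by decide) (by decide)
    have e3 := hk1 3 (by decide) (by decide)
    have e4 := hk1 4 (by decide) (by decide)
    have e13 := hk1 13 (by decide) (by decide)
    have e15 := hk1 15 (by decide) (by decide)
    simp [Instr.run, k2, k3, k4, k13, h15] at hf1 e2 e3 e4 e13 e15
    refine wp_block ⟨fun i' hi' => ?_, fun i' hi' => ?_⟩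
    · simp [Instr.run, hf1, e2, e3, e4, e13, e15, Function.update_apply]
      rw [if_neg (by omega)]
      split_ifs with h
      · rw [h]
      · exact hx i' (by omega)
    · simp [Instr.run, hf1, e2, e3, e4, e13, e15, Function.update_apply]
      by_cases h : i' = i
      · rw [if_pos (by omega), h]
        exact (Nat.mod_mod_of_dvd _ ⟨n + 1, rfl⟩).symm
      · rw [if_neg (by omega), if_neg (by omega)]
        exact hx' i' (by omega)
  · rintro s1 hk ⟨hx, hx'⟩
    rw [hs.r2] at hx hx'
    have k7 := (hk 7 rfl).trans hs.r7
    refine wp_block ⟨?_, ?_, fun i hi => ?_, fun i hi => ?_⟩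
    · simp [Instr.run]
    · simp [Instr.run, k7]
    · rw [← hx i hi]
      simp only [List.foldl, Instr.run]
      simp
      rw [Function.update_of_ne (by omega), Function.update_of_ne (by omega)]
    · rw [← hx' i hi]
      simp only [List.foldl, Instr.run]
      simp
      rw [Function.update_of_ne (by omega), Function.update_of_ne (by omega)]

/-- The whole program. -/
def blottoProg : Prog := .seq setupProg (.seq searchProg outputProg)

theorem wp_blottoProg {M n m k a b c e : ℕ} {w : ℕ → ℕ} {s : State}
    (hM : Bounded M n m k) (hs : Input n m k a b c e w s)
    (hwk : w k = if c = 0 then 0 else (a + b - 1) / b) (f U : ℕ) (W : ℕ → ℕ)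
    (hf : f = if c + c - e = 0 then 1 else 0) (hU : U = w k * ((n + 1) * (n + 1)) ^ k)
    (hW : W = fun i => w i * ((n + 1) * (n + 1)) ^ k) :
    Wp M blottoProg (fun s' => (∃ l ≤ k, ∃ d < 2 * (n + 1), Passes n m k U f W (W l + W l) (d + 1)) →
      ∃ l ≤ k, ∃ d < 2 * (n + 1), Passes n m k U f W (W l + W l) (d + 1) ∧
        ∀ C, C = code n k U f W (W l + W l) (d + 1) →
        s'.mem 0 = 1 ∧ s'.mem 1 = f ∧
        (∀ i < k, s'.mem (2 + i) = C / ((n + 1) * (n + 1)) ^ i % ((n + 1) * (n + 1)) / (n + 1)) ∧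
        ∀ i < k, s'.mem (2 + k + i) =
          C / ((n + 1) * (n + 1)) ^ i % ((n + 1) * (n + 1)) % (n + 1)) s := by
  subst hf hU hW
  refine wp_seq ((wp_setupProg hM hs hwk).mono ?_)
  rintro s1 ⟨hs1, hw1⟩
  refine wp_seq ((wp_searchProg hs1 hM hw1).frame.mono ?_)
  rintro s2 ⟨h2, hk⟩
  have hs2 := hs1.congr fun r (hr : r < 13) => by interval_cases r <;> exact hk _ rfl
  refine (wp_outputProg hs2 hM rfl).mono ?_
  intro s3 h3 hex
  obtain ⟨l, hl, d, hd, hp, hc⟩ := h2 hex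
  refine ⟨l, hl, d, hd, hp, ?_⟩
  rintro C rfl
  rwa [hc] at h3

end Blotto

/-! ### Correctness of the search -/

namespace Blotto

theorem price_mul_right {c : ℕ} (hc : 0 < c) (N D U w a b : ℕ) :
    price (N * c) D (U * c) (w * c) a b = price N D U w a b * c := by
  have h : U * c ≤ 3 * (w * c) ↔ U ≤ 3 * w := by
    rw [← mul_assoc, Nat.mul_le_mul_right_iff hc]
  have h1 : ∀ x, N * c * x = N * x * c := fun x => by ring
  have h2 : D * (w * c) = D * w * c := by ring
  unfold price
  simp only [h, h1, h2, ← Nat.add_mul]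
  split_ifs
  · rfl
  · rw [Nat.mul_min_mul_right, Nat.mul_min_mul_right]

/-- The sum of the prices of the choices `q`. -/
def totalPrice (n k U f : ℕ) (w : ℕ → ℕ) (N D : ℕ) (q : ℕ → ℕ) : ℕ :=
  ∑ i ∈ Finset.range k, price N D U (w i) (q i / (n + 1))
    (if f = 0 then q i / (n + 1) else q i % (n + 1))

theorem sum_entry {n k U f N D : ℕ} {w q : ℕ → ℕ} (c : ℕ) (hc : 0 < c) :
    ∑ i ∈ Finset.range k, entry (n + 1) f (N * c) D (U * c) (fun i => w i * c) i (q i) =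
      totalPrice n k U f w N D q * c +
        ∑ i ∈ Finset.range k, q i * ((n + 1) * (n + 1)) ^ i := by
  simp only [entry, price_mul_right hc, totalPrice, Finset.sum_add_distrib, Finset.sum_mul]

variable {n m k U f N D : ℕ} {w : ℕ → ℕ}

/-- A multiplier that passes yields choices with a large total price, which are the digits of the
recorded number. -/
theorem Passes.exists_choices (c : ℕ) (hc : c = ((n + 1) * (n + 1)) ^ k)
    (h : Passes n m k (U * c) f (fun i => w i * c) (N * c) D) :
    ∃ q : ℕ → ℕ, (∀ i, q i < (n + 1) * (n + 1)) ∧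
      ∑ i ∈ Finset.range k, q i / (n + 1) ≤ n ∧ ∑ i ∈ Finset.range k, q i % (n + 1) ≤ n ∧
      code n k (U * c) f (fun i => w i * c) (N * c) D =
        ∑ i ∈ Finset.range k, q i * ((n + 1) * (n + 1)) ^ i ∧
      2 * U * D + 3 * N * m ≤ 3 * totalPrice n k U f w N D q := by
  have hc0 : 0 < c := by rw [hc]; positivity
  obtain ⟨q, hq, h1, h2, h3⟩ := exists_sum_eq_best (B := n + 1)
    (g := entry (n + 1) f (N * c) D (U * c) (fun i => w i * c)) n.succ_pos k n n
  rw [sum_entry c hc0] at h3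
  have hlt := sum_mul_pow_lt hq k
  rw [← hc] at hlt
  have hcode : code n k (U * c) f (fun i => w i * c) (N * c) D =
      ∑ i ∈ Finset.range k, q i * ((n + 1) * (n + 1)) ^ i := by
    rw [code, ← hc, optimum, ← h3, Nat.mul_add_mod_self_right, Nat.mod_eq_of_lt hlt]
  refine ⟨q, hq, h1, h2, hcode, ?_⟩
  unfold Passes at h
  rw [hcode, optimum, ← h3, Nat.add_sub_cancel] at h
  refine Nat.le_of_mul_le_mul_right ?_ hc0
  linarith

theorem passes_of_choices (c : ℕ) (hc : c = ((n + 1) * (n + 1)) ^ k) {q : ℕ → ℕ}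
    (hq : ∀ i < k, q i < (n + 1) * (n + 1)) (h1 : ∑ i ∈ Finset.range k, q i / (n + 1) ≤ n)
    (h2 : ∑ i ∈ Finset.range k, q i % (n + 1) ≤ n)
    (h : 2 * U * D + 3 * N * m ≤ 3 * totalPrice n k U f w N D q) :
    Passes n m k (U * c) f (fun i => w i * c) (N * c) D := by
  have hc0 : 0 < c := by rw [hc]; positivity
  have h3 := sum_le_best (g := entry (n + 1) f (N * c) D (U * c) (fun i => w i * c)) hq h1 h2
  rw [sum_entry c hc0] at h3
  have h4 : totalPrice n k U f w N D q ≤ optimum n k (U * c) f (fun i => w i * c) (N * c) D / c :=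
    (Nat.le_div_iff_mul_le hc0).2 ((Nat.le_add_right _ _).trans h3)
  have h5 := Nat.div_add_mod (optimum n k (U * c) f (fun i => w i * c) (N * c) D) c
  have h6 : optimum n k (U * c) f (fun i => w i * c) (N * c) D -
      code n k (U * c) f (fun i => w i * c) (N * c) D =
        c * (optimum n k (U * c) f (fun i => w i * c) (N * c) D / c) := by
    rw [code, ← hc]
    omega
  unfold Passes
  rw [h6]
  have h7 := Nat.mul_le_mul_left c (h.trans (Nat.mul_le_mul_left 3 h4))
  linarith

/-- The weights of the battlefields, followed by the target utility. -/
def weights (G : Blotto) (U i : ℕ) : ℕ := if h : i < G.k then G.w ⟨i, h⟩ else U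

theorem totalPrice_weights (G : Blotto) (q : ℕ → ℕ) :
    totalPrice n G.k U f (G.weights U) N D q = ∑ i : Fin G.k, price N D U (G.w i)
      (q i / (n + 1)) (if f = 0 then q i / (n + 1) else q i % (n + 1)) := by
  rw [totalPrice, Finset.sum_range]
  simp [weights]

/-- If one strategy (for `f = 0`) or one of two strategies gets `U` against every strategy of the
opponent, some multiplier passes. -/
theorem exists_passes (G : Blotto) (U f c : ℕ) (hc : c = ((G.n + 1) * (G.n + 1)) ^ G.k)
    (x x' : Pure G.n G.k) (hf : f = 0 → x' = x)
    (h : ∀ y : Pure G.m G.k, U ≤ G.utility x y ∨ U ≤ G.utility x' y) :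
    ∃ l ≤ G.k, ∃ d < 2 * (G.n + 1), Passes G.n G.m G.k (U * c) f (fun i => G.weights U i * c)
      (2 * G.weights U l * c) (d + 1) := by
  have hle : ∀ (x : Pure G.n G.k) i, x.1 i ≤ G.n := fun x i =>
    (Finset.single_le_sum (f := x.1) (fun _ _ => Nat.zero_le _) (Finset.mem_univ i)).trans x.2
  obtain ⟨v, hv, d, hd, hp⟩ := exists_candidate (w := G.w) (x := x.1) (x' := x'.1) (U := U)
    (m := G.m) (n := G.n) (V := (Finset.range (G.k + 1)).image (G.weights U))
    (fun i => Finset.mem_image.2 ⟨i, Finset.mem_range.2 (by omega), by simp [weights]⟩)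
    (Finset.mem_image.2 ⟨G.k, Finset.mem_range.2 (by omega), by simp [weights]⟩) (hle x) (hle x')
    (fun y hy => h ⟨y, hy⟩)
  obtain ⟨l, hl, rfl⟩ := Finset.mem_image.1 hv
  refine ⟨l, Nat.le_of_lt_succ (Finset.mem_range.1 hl), d, hd, ?_⟩
  have hB : 0 < G.n + 1 := G.n.succ_pos
  set q : ℕ → ℕ := fun i => if h : i < G.k then x.1 ⟨i, h⟩ * (G.n + 1) + x'.1 ⟨i, h⟩ else 0 with hq
  have hqi : ∀ i : Fin G.k, q i = x.1 i * (G.n + 1) + x'.1 i := fun i => by simp [hq]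
  have hdiv : ∀ i : Fin G.k, q i / (G.n + 1) = x.1 i := fun i => by
    rw [hqi, mul_comm, Nat.mul_add_div hB, Nat.div_eq_of_lt (Nat.lt_succ_of_le (hle x' i)), add_zero]
  have hmod : ∀ i : Fin G.k, q i % (G.n + 1) = x'.1 i := fun i => by
    rw [hqi, mul_comm, Nat.mul_add_mod, Nat.mod_eq_of_lt (Nat.lt_succ_of_le (hle x' i))]
  refine passes_of_choices c hc (q := q) (fun i hi => ?_) ?_ ?_ ?_
  · rw [← Nat.div_lt_iff_lt_mul hB, hdiv ⟨i, hi⟩]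
    exact Nat.lt_succ_of_le (hle x _)
  · rw [Finset.sum_range]
    simpa only [hdiv] using x.2
  · rw [Finset.sum_range]
    simpa only [hmod] using x'.2
  · rw [totalPrice_weights]
    refine hp.trans (le_of_eq ?_)
    congr 1
    refine Finset.sum_congr rfl fun i _ => ?_
    rw [hdiv, hmod]
    split_ifs with h0
    · rw [hf h0]
    · rfl

/-- The choices recorded for a multiplier that passes are one strategy (for `f = 0`) or two strategies
with the desired guarantee. -/
theorem Passes.exists_strategies {G : Blotto} {U f c l d : ℕ}
    (hc : c = ((G.n + 1) * (G.n + 1)) ^ G.k)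
    (h : Passes G.n G.m G.k (U * c) f (fun i => G.weights U i * c)
      (2 * G.weights U l * c) (d + 1)) (C : ℕ)
    (hC : C = code G.n G.k (U * c) f (fun i => G.weights U i * c) (2 * G.weights U l * c) (d + 1)) :
    ∃ x x' : Pure G.n G.k,
      (∀ i : Fin G.k, x.1 i =
        C / ((G.n + 1) * (G.n + 1)) ^ i.1 % ((G.n + 1) * (G.n + 1)) / (G.n + 1)) ∧
      (∀ i : Fin G.k, x'.1 i =
        C / ((G.n + 1) * (G.n + 1)) ^ i.1 % ((G.n + 1) * (G.n + 1)) % (G.n + 1)) ∧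
      ∀ y : Pure G.m G.k, U ≤ 3 * G.utility x y ∨ U ≤ 3 * G.utility (if f = 0 then x else x') y := by
  obtain ⟨q, hq, h1, h2, h3, h4⟩ := h.exists_choices c hc
  rw [Finset.sum_range] at h1 h2
  rw [totalPrice_weights] at h4
  have hdig : ∀ i : Fin G.k,
      C / ((G.n + 1) * (G.n + 1)) ^ i.1 % ((G.n + 1) * (G.n + 1)) = q i := fun i => by
    rw [hC, h3, digit_sum_mul_pow hq i.2]
  refine ⟨⟨fun i => q i / (G.n + 1), h1⟩, ⟨fun i => q i % (G.n + 1), h2⟩, fun i => by rw [hdig],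
    fun i => by rw [hdig], fun y => ?_⟩
  split_ifs with h0
  · simp only [h0, if_true] at h4
    exact le_gain_of_le_sum_price d.succ_pos h4 y.1 y.2
  · simp only [h0, if_false] at h4
    exact le_gain_of_le_sum_price d.succ_pos h4 y.1 y.2

/-! ### Mixed strategies with at most two pure strategies -/

theorem winProb_pure (G : Blotto) (u : ℝ) (σ : PMF (Pure G.n G.k)) (y : Pure G.m G.k) :
    G.winProb u σ (PMF.pure y) = σ.toOuterMeasure {x | u ≤ (G.utility x y : ℝ)} := by
  rw [winProb]
  simp only [PMF.pure_map]
  change (σ.bind (PMF.pure ∘ fun x => (x, y))).toOuterMeasure _ = _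
  rw [PMF.bind_pure_comp, PMF.toOuterMeasure_map_apply]
  rfl

theorem exists_support_subset_pair {α : Type*} (σ : PMF α) (h : σ.support.encard ≤ 2) :
    ∃ x x', σ.support ⊆ {x, x'} := by
  classical
  obtain ⟨x, hx⟩ := σ.support_nonempty
  by_cases hs : σ.support ⊆ {x}
  · exact ⟨x, x, by simpa using hs⟩
  obtain ⟨x', hx', hne⟩ := Set.not_subset.1 hs
  refine ⟨x, x', fun z hz => ?_⟩
  by_contra hz'
  simp only [Set.mem_insert_iff, Set.mem_singleton_iff, not_or] at hz' hne
  have : ({z, x, x'} : Set α) ⊆ σ.support := by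
    rintro _ (rfl | rfl | rfl) <;> assumption
  have h3 : ({z, x, x'} : Set α).encard = 3 :=
    Set.encard_eq_three.2 ⟨z, x, x', hz'.1, hz'.2, fun h => hne h.symm, rfl⟩
  have h4 := (Set.encard_le_encard this).trans h
  rw [h3] at h4
  exact absurd h4 (by decide)

/-- The pure strategies of a maxmin 2-strategy: one of them wins against every strategy of the
opponent, and if the probability of winning exceeds `1 / 2`, always the same one wins. -/
theorem IsMaxmin.exists_pair {G : Blotto} {u p : ℝ} {σ : PMF (Pure G.n G.k)} (h : G.IsMaxmin u p σ)
    (h2 : G.IsCStrategy 2 σ) (hp : 0 < p) : ∃ x x' : Pure G.n G.k, (1 / 2 < p → x' = x) ∧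
      ∀ y, u ≤ (G.utility x y : ℝ) ∨ u ≤ (G.utility x' y : ℝ) := by
  obtain ⟨x, x', hs⟩ := exists_support_subset_pair σ h2
  have hy : ∀ y, ENNReal.ofReal p ≤ σ.toOuterMeasure {x | u ≤ (G.utility x y : ℝ)} := fun y => by
    rw [← winProb_pure]
    exact h _
  have hor : ∀ y, u ≤ (G.utility x y : ℝ) ∨ u ≤ (G.utility x' y : ℝ) := by
    intro y
    have h0 : σ.toOuterMeasure {x | u ≤ (G.utility x y : ℝ)} ≠ 0 :=
      ((ENNReal.ofReal_pos.2 hp).trans_le (hy y)).ne'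
    rw [Ne, PMF.toOuterMeasure_apply_eq_zero_iff, Set.not_disjoint_iff] at h0
    obtain ⟨z, hz, hz'⟩ := h0
    rcases hs hz with rfl | rfl
    · exact .inl hz'
    · exact .inr hz'
  by_cases hp2 : 1 / 2 < p
  swap
  · exact ⟨x, x', fun h => absurd h hp2, hor⟩
  by_cases hx : ∀ y, u ≤ (G.utility x y : ℝ)
  · exact ⟨x, x, fun _ => rfl, fun y => .inl (hx y)⟩
  by_cases hx' : ∀ y, u ≤ (G.utility x' y : ℝ)
  · exact ⟨x', x', fun _ => rfl, fun y => .inl (hx' y)⟩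
  -- otherwise both pure strategies have probability more than `1 / 2`
  exfalso
  push Not at hx hx'
  obtain ⟨y, hxy⟩ := hx
  obtain ⟨y', hxy'⟩ := hx'
  have h1 : ENNReal.ofReal p ≤ σ x' := by
    refine (hy y).trans ?_
    rw [← PMF.toOuterMeasure_apply_singleton]
    refine PMF.toOuterMeasure_mono _ ?_
    rintro z ⟨hz, hzs⟩
    rcases hs hzs with rfl | rfl
    · exact absurd hz (not_le.2 hxy)
    · rfl
  have h3 : ENNReal.ofReal p ≤ σ x := by
    refine (hy y').trans ?_
    rw [← PMF.toOuterMeasure_apply_singleton]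
    refine PMF.toOuterMeasure_mono _ ?_
    rintro z ⟨hz, hzs⟩
    rcases hs hzs with rfl | rfl
    · rfl
    · exact absurd hz (not_le.2 hxy')
  have hne : x ≠ x' := by
    rintro rfl
    exact absurd (hor y) (by simpa using hxy)
  have hsum : σ x + σ x' ≤ 1 := by
    classical
    rw [← Finset.sum_pair hne, ← σ.tsum_coe]
    exact ENNReal.sum_le_tsum _
  have h4 := (add_le_add h3 h1).trans hsum
  rw [← ENNReal.ofReal_add hp.le hp.le, ENNReal.ofReal_le_one] at h4
  linarith

theorem IsMaxmin.le_one {G : Blotto} {u p : ℝ} {σ : PMF (Pure G.n G.k)} (h : G.IsMaxmin u p σ) :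
    p ≤ 1 := by
  have h1 := h (PMF.pure ⟨fun _ => 0, by simp⟩)
  rw [winProb_pure] at h1
  have h2 := h1.trans (MeasureTheory.measure_mono (Set.subset_univ _))
  rw [(PMF.toOuterMeasure_apply_eq_one_iff _ _).2 (Set.subset_univ _)] at h2
  exact ENNReal.ofReal_le_one.1 h2

/-- The strategy that plays each of `x` and `x'` with probability `1 / 2`. -/
noncomputable def half {α : Type*} (x x' : α) : PMF α :=
  (PMF.uniformOfFintype Bool).map fun b => if b then x else x'

theorem half_apply {α : Type*} [DecidableEq α] (x x' z : α) :
    half x x' z = (if z = x then (1 : ℝ≥0∞) / (1 + 1) else 0) +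
      (if z = x' then (1 : ℝ≥0∞) / (1 + 1) else 0) := by
  rw [half, PMF.map_apply, tsum_bool]
  simp [one_add_one_eq_two, add_comm]

theorem half_support {α : Type*} (x x' : α) : (half x x').support ⊆ {x, x'} := by
  rw [half, PMF.support_map]
  rintro _ ⟨b, -, rfl⟩
  cases b <;> simp

theorem isMaxmin_half {G : Blotto} {u p : ℝ} {x x' : Pure G.n G.k} (hp : p ≤ 1 / 2)
    (h : ∀ y, u ≤ (G.utility x y : ℝ) ∨ u ≤ (G.utility x' y : ℝ)) :
    G.IsMaxmin u p (half x x') := by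
  intro τ
  rw [winProb, half, PMF.bind_map, PMF.toOuterMeasure_bind_apply, tsum_bool]
  simp only [Function.comp_apply, PMF.uniformOfFintype_apply, Fintype.card_bool,
    PMF.toOuterMeasure_map_apply, ← mul_add]
  have h1 : (1 : ℝ≥0∞) ≤ τ.toOuterMeasure {y | u ≤ (G.utility x' y : ℝ)} +
      τ.toOuterMeasure {y | u ≤ (G.utility x y : ℝ)} := by
    rw [← (PMF.toOuterMeasure_apply_eq_one_iff τ Set.univ).2 (Set.subset_univ _)]
    refine (τ.toOuterMeasure.mono fun y _ => ?_).trans (MeasureTheory.measure_union_le _ _)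
    exact (h y).symm
  have h2 : ENNReal.ofReal p ≤ 2⁻¹ := by
    refine (ENNReal.ofReal_le_ofReal hp).trans ?_
    rw [one_div, ENNReal.ofReal_inv_of_pos two_pos]
    simp
  calc ENNReal.ofReal p ≤ 2⁻¹ * 1 := by simpa using h2
    _ ≤ 2⁻¹ * _ := mul_le_mul_right h1 _

theorem isMaxmin_pure {G : Blotto} {u p : ℝ} {x : Pure G.n G.k} (hp : p ≤ 1)
    (h : ∀ y, u ≤ (G.utility x y : ℝ)) : G.IsMaxmin u p (PMF.pure x) := by
  intro τ
  have h1 : τ.toOuterMeasure ((fun y => (x, y)) ⁻¹' {z | u ≤ (G.utility z.1 z.2 : ℝ)}) = 1 :=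
    (PMF.toOuterMeasure_apply_eq_one_iff _ _).2 fun y _ => h y
  rw [winProb, PMF.pure_bind, PMF.toOuterMeasure_map_apply, h1]
  exact ENNReal.ofReal_le_one.2 hp

/-! ### The algorithm -/

theorem input_init (G : Blotto) (u p : ℚ≥0) (U : ℕ) :
    Input G.n G.m G.k u.num u.den p.num p.den (G.weights U) (RAM.init (G.encode u p)) := by
  refine ⟨rfl, rfl, rfl, rfl, rfl, rfl, rfl, fun i hi => ?_, fun x => ?_⟩
  · simp [RAM.init, encode, weights, hi, Nat.add_comm 7]
  · simp [RAM.init, encode, show 8 + G.k + x = G.k + x + 1 + 7 by omega]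
    rw [dif_neg (by omega)]
    rfl

theorem ceil_le_iff (u : ℚ≥0) (g : ℕ) : (u.num + u.den - 1) / u.den ≤ g ↔ (u : ℝ) ≤ g := by
  have hd : 0 < u.den := u.den_pos
  have hd' : (0 : ℝ) < u.den := by exact_mod_cast hd
  rw [NNRat.cast_def, div_le_iff₀ hd', ← Nat.lt_succ_iff, Nat.div_lt_iff_lt_mul hd, Nat.succ_mul]
  have : u.num + u.den - 1 < g * u.den + u.den ↔ u.num ≤ g * u.den := by omega
  rw [this]
  exact_mod_cast Iff.rfl

theorem bounded_of_inputSize (G : Blotto) (u p : ℚ≥0) :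
    Bounded (2 * (G.inputSize u p + 1) ^ 3) G.n G.m G.k := by
  set N := G.inputSize u p with hN
  have h1 : G.n ≤ N ∧ G.m ≤ N ∧ G.k ≤ N := by
    rw [hN, inputSize]
    omega
  obtain ⟨hn, hm, hk⟩ := h1
  have h2 : N + 1 ≤ (N + 1) ^ 3 := Nat.le_self_pow (by decide) _
  have h3 : (G.n + 1) * (G.n + 1) ≤ (N + 1) * (N + 1) := Nat.mul_le_mul (by omega) (by omega)
  have h4 : (N + 1) ^ 3 = (N + 1) * (N + 1) * (N + 1) := by ring
  have h5 : (G.n + 1) * (G.n + 1) * G.k ≤ (N + 1) * (N + 1) * (N + 1) :=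
    Nat.mul_le_mul h3 (by omega)
  have h6 : (N + 1) * (N + 1) * 1 ≤ (N + 1) * (N + 1) * (N + 1) :=
    Nat.mul_le_mul_left _ (by omega)
  constructor <;> omega

end Blotto

/-- There is one algorithm, running in polynomial time on every input, which outputs a
`(u / 3, p)`-maxmin 2-strategy of player 1 whenever he has a `(u, p)`-maxmin 2-strategy. -/
theorem mainTheorem6 :
    ∃ (A : RAM.Prog) (P : Polynomial ℕ), ∀ (G : Blotto) (u p : ℚ≥0),
      ∃ (t : ℕ) (s : RAM.State),
        RAM.Exec A (RAM.init (G.encode u p)) t s ∧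
        t ≤ P.eval (G.inputSize u p) ∧
        ((∃ σ : PMF (Blotto.Pure G.n G.k), G.IsCStrategy 2 σ ∧ G.IsMaxmin (u : ℝ) (p : ℝ) σ) →
          ∃ σ : PMF (Blotto.Pure G.n G.k), G.Outputs s σ ∧ G.IsCStrategy 2 σ ∧
            G.IsMaxmin ((u : ℝ) / 3) (p : ℝ) σ) := by
  classical
  refine ⟨Blotto.blottoProg, Blotto.blottoProg.timeBound.comp (2 * (Polynomial.X + 1) ^ 3),
    fun G u p => ?_⟩
  set U := if p.num = 0 then 0 else (u.num + u.den - 1) / u.den with hU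
  set c := ((G.n + 1) * (G.n + 1)) ^ G.k with hc
  have hUk : G.weights U G.k = U := by simp [Blotto.weights]
  have hp0 : p.num = 0 ↔ (p : ℝ) = 0 := by
    have hd : (p.den : ℝ) ≠ 0 := by exact_mod_cast p.den_ne_zero
    rw [NNRat.cast_def, div_eq_zero_iff, or_iff_left hd, Nat.cast_eq_zero]
  have hp2 : p.num + p.num - p.den = 0 ↔ (p : ℝ) ≤ 1 / 2 := by
    have hd : (0 : ℝ) < p.den := by exact_mod_cast p.den_pos
    rw [NNRat.cast_def, div_le_iff₀ hd, Nat.sub_eq_zero_iff_le, ← Nat.cast_le (α := ℝ)]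
    push_cast
    constructor <;> intro h <;> linarith
  set f := if p.num + p.num - p.den = 0 then 1 else 0 with hf
  obtain ⟨t, s, h1, h2, h3⟩ := Blotto.wp_blottoProg (Blotto.bounded_of_inputSize G u p)
    (Blotto.input_init G u p U) (hUk.trans hU) f (U * c) (fun i => G.weights U i * c) hf
    (by rw [hUk]) rfl
  refine ⟨t, s, h1, by simpa using h2, ?_⟩
  rintro ⟨σ, hσ2, hσ⟩
  have hp1 := hσ.le_one
  -- a pair of pure strategies which shows that the search succeeds
  have hpair : ∃ x x' : Blotto.Pure G.n G.k, (f = 0 → x' = x) ∧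
      ∀ y, U ≤ G.utility x y ∨ U ≤ G.utility x' y := by
    by_cases h0 : p.num = 0
    · refine ⟨⟨fun _ => 0, by simp⟩, ⟨fun _ => 0, by simp⟩, fun _ => rfl, fun y => .inl ?_⟩
      rw [hU, if_pos h0]
      exact Nat.zero_le _
    · have hpos : (0 : ℝ) < p := lt_of_le_of_ne (NNRat.cast_nonneg p) fun h => h0 (hp0.2 h.symm)
      obtain ⟨x, x', hx, hxy⟩ := hσ.exists_pair hσ2 hpos
      refine ⟨x, x', fun hf0 => hx ?_, fun y => ?_⟩
      · by_contra! hle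
        rw [hf, if_pos (hp2.2 hle)] at hf0
        exact absurd hf0 one_ne_zero
      · rw [hU, if_neg h0]
        exact (hxy y).imp (Blotto.ceil_le_iff u _).2 (Blotto.ceil_le_iff u _).2
  obtain ⟨x₀, x₀', hx₀, hxy₀⟩ := hpair
  obtain ⟨l, hl, d, hd, hpass⟩ := Blotto.exists_passes G U f c hc x₀ x₀' hx₀ hxy₀
  have h2w : ∀ l, G.weights U l * c + G.weights U l * c = 2 * G.weights U l * c := fun l => by ring
  simp only [h2w] at h3
  obtain ⟨l, hl, d, hd, hpass, hout⟩ := h3 ⟨l, hl, d, hd, hpass⟩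
  obtain ⟨x, x', hx, hx', hgood⟩ := hpass.exists_strategies hc _ rfl
  obtain ⟨o0, o1, o2, o3⟩ := hout _ rfl
  have hutil : p.num ≠ 0 → ∀ g : ℕ, U ≤ 3 * g → (u : ℝ) / 3 ≤ g := by
    intro h0 g hg
    rw [hU, if_neg h0, Blotto.ceil_le_iff] at hg
    push_cast at hg
    linarith
  by_cases hle : (p : ℝ) ≤ 1 / 2
  · have hf1 : f = 1 := by rw [hf, if_pos (hp2.2 hle)]
    refine ⟨Blotto.half x x', ⟨1, 1, x, x', o0, o1.trans hf1, by decide, fun i => ?_, fun i => ?_,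
      fun z => ?_⟩, ?_, ?_⟩
    · rw [o2 i i.2, hx]
    · rw [o3 i i.2, hx']
    · rw [Blotto.half_apply]
      simp
    · refine (Set.encard_le_encard (Blotto.half_support x x')).trans ?_
      refine (Set.encard_insert_le _ _).trans ?_
      rw [Set.encard_singleton]
      norm_num
    · by_cases h0 : p.num = 0
      · intro τ
        rw [hp0.1 h0, ENNReal.ofReal_zero]
        exact zero_le
      · refine Blotto.isMaxmin_half hle fun y => ?_
        have := hgood y
        rw [hf1, if_neg one_ne_zero] at this
        exact this.imp (hutil h0 _) (hutil h0 _)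
  · have hf0 : f = 0 := by rw [hf, if_neg fun h => hle (hp2.1 h)]
    have h0 : p.num ≠ 0 := fun h => hle (by rw [hp0.1 h]; norm_num)
    refine ⟨PMF.pure x, ⟨1, 0, x, x', o0, o1.trans hf0, by decide, fun i => ?_, fun i => ?_,
      fun z => ?_⟩, ?_, ?_⟩
    · rw [o2 i i.2, hx]
    · rw [o3 i i.2, hx']
    · simp [PMF.pure_apply]
    · rw [Blotto.IsCStrategy, PMF.support_pure, Set.encard_singleton]
      norm_num
    · refine Blotto.isMaxmin_pure hp1 fun y => ?_
      have := hgood y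
      rw [hf0, if_pos rfl, or_self] at this
      exact hutil h0 _ this
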